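/- Let $\mathcal{Y}$ be a separable real Hilbert space, let $X_1,X_2,\dots$ be i.i.d. random variables on a probability space $(\Omega,\mathscr{F},\mathbb{P})$ with values in a measurable space $\mathcal{X}$ and common law $P$, and let $P_n=\frac1n\sum_{i=1}^n\delta_{X_i}$. Let $\mathcal{G}\subset L^1(\mathcal{X},P;\mathcal{Y})$ be a class of functions $\mathcal{X}\to\mathcal{Y}$, and write $\nu_n(g)=\sqrt n\,(P_n-P)g=\sqrt n\big(\frac1n\sum_{i=1}^n g(X_i)-\int g\,dP\big)$ for $g\in\mathcal{G}$. Suppose that the envelope $G(x)=\sup_{g\in\mathcal{G}}\lVert g(x)\rVert_{\mathcal{Y}}$ is finite for every $x\in\mathcal{X}$ and that $G\in L^2(\mathcal{X},P;\mathbb{R})$. For a measure $Q$ write $\lVert g\rVert_{2,Q}=\big(\int\lVert g\rVert_{\mathcal{Y}}^2\,dQ\big)^{1/2}$, and for $r\ge 0$ let $H(r,\mathcal{G},\lVert\cdot\rVert_{2,Q})=\log N(r,\mathcal{G},\lVert\cdot\rVert_{2,Q})$, where $N(r,\mathcal{G},\lVert\cdot\rVert_{2,Q})\in\mathbb{N}\cup\{\infty\}$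 is the least number of closed $\lVert\cdot\rVert_{2,Q}$-balls of radius $r$ with centres in $\mathcal{G}$ that cover $\mathcal{G}$. Suppose that $\mathcal{G}$ satisfies the uniform entropy condition: there is a decreasing function $H:(0,\infty)\to\mathbb{R}$ with $\int_0^1\sqrt{H(u)}\,du<\infty$ such that $$H\big(u\lVert G\rVert_{2,Q},\mathcal{G},\lVert\cdot\rVert_{2,Q}\big)\le H(u)$$ for all $u>0$ and all probability distributions $Q$ on $\mathcal{X}$ with finite support. Suppose moreover that the following suprema are measurable: for all $g_0\in\mathcal{G}$, $\delta>0$, $n\in\mathbb{N}$ and all signs $\sigma_1,\dots,\sigma_n\in\{-1,1\}$, the maps $$(x_1,\dots,x_n)\mapsto\sup_{g}\Big\lVert\sum_{i=1}^n\sigma_i\,(g-g_0)(x_i)\Big\rVert_{\mathcal{Y}}\qquad\text{and}\qquad(x_1,\dots,x_n)\mapsto\sup_{g}\Big|\sum_{i=1}^n\sigma_i\,\lVert (g-g_0)(x_i)\rVert_{\mathcal{Y}}^2\Big|,$$ with both suprema over $\{g\in\mathcal{G}:\lVert g-g_0\rVert_{2,P}\le\delta\}$, are measurable with respect to the completion of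 the product measure $P^n$ (this holds, for instance, if $\mathcal{G}$ is countable). Then the empirical process $\{\nu_n(g):g\in\mathcal{G}\}$ is asymptotically equicontinuous at every $g_0\in\mathcal{G}$: for every sequence $\hat g_n$ of random elements of $\mathcal{G}$ (arbitrary maps $\hat g_n:\Omega\to\mathcal{G}$, with convergence in probability understood in outer probability where needed), if $\lVert\hat g_n-g_0\rVert_{2,P}\to0$ in probability, then $\lVert\nu_n(\hat g_n)-\nu_n(g_0)\rVert_{\mathcal{Y}}\to0$ in probability. -/

import Mathlib

open MeasureTheory ProbabilityTheory Filter Topology Set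
open scoped ENNReal NNReal

noncomputable section

namespace VectorEmpirical

variable {S : Type*} {Y : Type*} [NormedAddCommGroup Y]

/-- The envelope `G(x) = sup_{g ∈ 𝒢} ‖g(x)‖` of a class of functions. (It is only used for classes
that are pointwise bounded, so that this supremum is a real number.) -/
def envelope (𝒢 : Set (S → Y)) (x : S) : ℝ :=
  ⨆ g : 𝒢, ‖(g : S → Y) x‖

/-- The seminorm `‖g‖_{2,Q} = (∑ₓ Q(x) ‖g(x)‖²)^{1/2}` for a discrete probability distribution `Q`.
(It is only used for `Q` with finite support, where the sum is finite.) -/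
def discreteL2 (Q : PMF S) (g : S → Y) : ℝ :=
  Real.sqrt (∑' x, (Q x).toReal * ‖g x‖ ^ 2)

/-- The covering number `N(r, 𝒢, ‖·‖_{2,Q})`: the least number of closed balls of radius `r` with
centres in `𝒢` that cover `𝒢`, and `∞` if there is no finite cover. -/
def coveringNumberL2 (r : ℝ) (𝒢 : Set (S → Y)) (Q : PMF S) : ℕ∞ :=
  ⨅ (C : Set (S → Y)) (_ : C ⊆ 𝒢) (_ : ∀ g ∈ 𝒢, ∃ c ∈ C, discreteL2 Q (g - c) ≤ r), C.encard

/-- The entropy `H(r, 𝒢, ‖·‖_{2,Q}) = log N(r, 𝒢, ‖·‖_{2,Q})`, an extended real number. -/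
def entropyL2 (r : ℝ) (𝒢 : Set (S → Y)) (Q : PMF S) : EReal :=
  ENNReal.log ((coveringNumberL2 r 𝒢 Q : ℕ∞) : ℝ≥0∞)

/-- The uniform entropy condition: for a decreasing real function `H` of `u > 0` with
`∫₀¹ √H(u) du < ∞`, the entropy of `𝒢` at scale `u ‖G‖_{2,Q}` (`G` the envelope) is at most `H(u)`,
for all `u > 0` and all probability distributions `Q` with finite support. -/
def UniformEntropyCondition (𝒢 : Set (S → Y)) : Prop :=
  ∃ H : ℝ → ℝ, AntitoneOn H (Ioi 0) ∧
    IntegrableOn (fun u => Real.sqrt (H u)) (Ioo 0 1) volume ∧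
    ∀ u : ℝ, 0 < u → ∀ Q : PMF S, Q.support.Finite →
      entropyL2 (u * discreteL2 Q (envelope 𝒢)) 𝒢 Q ≤ ((H u : ℝ) : EReal)

variable [NormedSpace ℝ Y] [MeasurableSpace S]

/-- Measurability of the symmetrised suprema of a class `F`: for every sample size `n` and all signs
`σ₁, …, σₙ ∈ {-1, 1}`, the map `(x₁, …, xₙ) ↦ sup_{f ∈ F} ‖∑ᵢ σᵢ f(xᵢ)‖` is measurable for the
completion of `Pⁿ`. -/
def MeasurableSuprema (P : Measure S) (F : Set (S → Y)) : Prop :=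
  ∀ (n : ℕ) (σ : Fin n → ℝ), (∀ i, σ i = 1 ∨ σ i = -1) →
    AEMeasurable (fun x : Fin n → S => ⨆ f ∈ F, ‖∑ i, σ i • f (x i)‖ₑ)
      (Measure.pi fun _ : Fin n => P)

/-- The `L²(P)`-ball `{g ∈ 𝒢 : ‖g - g₀‖_{2,P} ≤ δ}`. -/
def localBall (P : Measure S) (𝒢 : Set (S → Y)) (g₀ : S → Y) (δ : ℝ) : Set (S → Y) :=
  {g | g ∈ 𝒢 ∧ eLpNorm (g - g₀) 2 P ≤ ENNReal.ofReal δ}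

/-- The measurability condition on a class `𝒢`: for all `g₀ ∈ 𝒢` and `δ > 0`, the classes of
functions `g - g₀` and `‖g - g₀‖²`, with `g` in the `L²(P)`-ball of radius `δ` around `g₀`, have
measurable symmetrised suprema. -/
def MeasurableClass (P : Measure S) (𝒢 : Set (S → Y)) : Prop :=
  ∀ g₀ ∈ 𝒢, ∀ δ : ℝ, 0 < δ →
    MeasurableSuprema P ((fun g : S → Y => g - g₀) '' localBall P 𝒢 g₀ δ) ∧
    MeasurableSuprema P ((fun (g : S → Y) (x : S) => ‖g x - g₀ x‖ ^ 2) '' localBall P 𝒢 g₀ δ)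

variable {Ω : Type*}

/-- The empirical process `νₙ(g) = √n (Pₙ - P) g`, where `Pₙ g = (1/n) ∑_{i<n} g(Xᵢ)` and
`P g = ∫ g dP` is the Bochner integral. -/
def empiricalNu (P : Measure S) (X : ℕ → Ω → S) (n : ℕ) (g : S → Y) (ω : Ω) : Y :=
  Real.sqrt n • ((n : ℝ)⁻¹ • (∑ i ∈ Finset.range n, g (X i ω)) - ∫ x, g x ∂P)

/-- Asymptotic equicontinuity at `g₀`: for every sequence of random elements `ĝₙ` of `𝒢`, if
`‖ĝₙ - g₀‖_{2,P} → 0` in probability then `‖νₙ(ĝₙ) - νₙ(g₀)‖ → 0` in probability. The `ĝₙ` may be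
arbitrary maps; `μ` of a non-measurable set is its outer probability. (The real value of the seminorm
is only used for square-integrable functions, where it is finite.) -/
def AsymptoticallyEquicontinuousAt [MeasurableSpace Ω] (μ : Measure Ω) (P : Measure S)
    (X : ℕ → Ω → S) (𝒢 : Set (S → Y)) (g₀ : S → Y) : Prop :=
  ∀ ghat : ℕ → Ω → (S → Y), (∀ n ω, ghat n ω ∈ 𝒢) →
    TendstoInMeasure μ (fun n ω => (eLpNorm (ghat n ω - g₀) 2 P).toReal) atTop (fun _ => 0) →
    TendstoInMeasure μ
      (fun n ω => ‖empiricalNu P X n (ghat n ω) ω - empiricalNu P X n g₀ ω‖)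
      atTop (fun _ => 0)

/-- The empirical process indexed by `𝒢` is asymptotically equicontinuous at every `g₀ ∈ 𝒢`. -/
def AsymptoticallyEquicontinuous [MeasurableSpace Ω] (μ : Measure Ω) (P : Measure S)
    (X : ℕ → Ω → S) (𝒢 : Set (S → Y)) : Prop :=
  ∀ g₀ ∈ 𝒢, AsymptoticallyEquicontinuousAt μ P X 𝒢 g₀

end VectorEmpirical

end

/-! The supremum of the centred sums over a small `L²(P)` ball around `g₀` has a measurable majorant
of mean at most `η √n`, and Markov's inequality then gives the claim. The majorant serves all `g` in
the ball at once, so `ĝₙ` may be an arbitrary map.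

Symmetrisation (`exists_centered_majorant`) replaces centred sums by randomly signed ones, with the
sample frozen. Signed sums in a Hilbert space are sub-Gaussian with constants free of the dimension
(`cosh_norm_add_add_cosh_norm_sub_le`), so Dudley chaining (`sum_iSup_signedSum_le`) bounds them by
entropy in the empirical `L²` norm. The entropy condition covers the empirical distribution of every
sample: the links beyond level `k₀` contribute the tail of a convergent series, and the start
contributes a constant times the empirical radius of the ball.

The ball is small in `L²(P)`, however, not in the empirical norm. A uniform law of large numbers for
`‖g - g₀‖²` (`exists_sq_majorant`) closes this gap. It follows from the same two tools: on a sample,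
squaring is Lipschitz with constant proportional to the largest envelope value, and `max G² = o(n)`
in mean because `G ∈ L²`. Choosing `k₀`, then `δ`, then `n₀` yields `exists_local_majorant`. -/

namespace VectorEmpirical

/-! ### Signed sums of vectors. -/

section SignedSum

variable {Z : Type*} [NormedAddCommGroup Z] [NormedSpace ℝ Z]

/-- The sign `±1` encoded by a Boolean. -/
def boolSign (b : Bool) : ℝ := if b then 1 else -1

/-- The signed sum `∑ᵢ τᵢ vᵢ`. -/
def signedSum {n : ℕ} (τ : Fin n → Bool) (v : Fin n → Z) : Z := ∑ i, boolSign (τ i) • v i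

theorem boolSign_eq (b : Bool) : boolSign b = 1 ∨ boolSign b = -1 := by
  cases b <;> simp [boolSign]

theorem abs_boolSign (b : Bool) : |boolSign b| = 1 := by
  cases b <;> simp [boolSign]

theorem signedSum_add {n : ℕ} (τ : Fin n → Bool) (v w : Fin n → Z) :
    signedSum τ (v + w) = signedSum τ v + signedSum τ w := by
  simp [signedSum, Finset.sum_add_distrib]

theorem signedSum_smul {n : ℕ} (τ : Fin n → Bool) (c : ℝ) (v : Fin n → Z) :
    signedSum τ (c • v) = c • signedSum τ v := by
  simp only [signedSum, Finset.smul_sum, Pi.smul_apply]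
  exact Finset.sum_congr rfl fun i _ => smul_comm _ _ _

theorem norm_signedSum_le {n : ℕ} (τ : Fin n → Bool) (v : PiLp 2 fun _ : Fin n => Z) :
    ‖signedSum τ v‖ ≤ n * ‖v‖ := by
  calc ‖signedSum τ v‖ ≤ ∑ i : Fin n, ‖v‖ := by
        refine (norm_sum_le _ _).trans (Finset.sum_le_sum fun i _ => ?_)
        rw [norm_smul, Real.norm_eq_abs, abs_boolSign, one_mul]
        exact PiLp.norm_apply_le v i
    _ = n * ‖v‖ := by simp

end SignedSum

/-! ### Sub-Gaussian bounds for random signs in a Hilbert space. -/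

section Rademacher

variable {Z : Type*} [NormedAddCommGroup Z] [InnerProductSpace ℝ Z]

/-- Only even powers of the norms enter the power series of `cosh`. The squares are `a ± b` on the
left and `a ± c` on the right, with `|b| ≤ c` by Cauchy-Schwarz, so convexity of `s ^ k` on `[0, ∞)`
compares the series term by term. -/
theorem cosh_norm_add_add_cosh_norm_sub_le (x v : Z) :
    Real.cosh ‖x + v‖ + Real.cosh ‖x - v‖ ≤ 2 * (Real.cosh ‖x‖ * Real.cosh ‖v‖) := by
  have key : 2 * (Real.cosh ‖x‖ * Real.cosh ‖v‖)
      = Real.cosh (‖x‖ + ‖v‖) + Real.cosh (‖x‖ - ‖v‖) := by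
    rw [Real.cosh_add, Real.cosh_sub]; ring
  rw [key]
  refine hasSum_le (fun k => ?_) ((Real.hasSum_cosh ‖x + v‖).add (Real.hasSum_cosh ‖x - v‖))
    ((Real.hasSum_cosh (‖x‖ + ‖v‖)).add (Real.hasSum_cosh (‖x‖ - ‖v‖)))
  rw [← add_div, ← add_div]
  refine div_le_div_of_nonneg_right ?_ (by positivity)
  simp only [pow_mul]
  set a := ‖x‖ ^ 2 + ‖v‖ ^ 2 with ha
  set b := 2 * inner ℝ x v with hb
  set c := 2 * (‖x‖ * ‖v‖) with hc
  have h1 : ‖x + v‖ ^ 2 = a + b := by rw [norm_add_sq_real]; ring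
  have h2 : ‖x - v‖ ^ 2 = a - b := by rw [norm_sub_sq_real]; ring
  have h3 : (‖x‖ + ‖v‖) ^ 2 = a + c := by ring
  have h4 : (‖x‖ - ‖v‖) ^ 2 = a - c := by ring
  have hbc : |b| ≤ c := by
    rw [hb, hc, abs_mul, abs_two]
    exact mul_le_mul_of_nonneg_left (abs_real_inner_le_norm x v) zero_le_two
  have hca : 0 ≤ a - c := by rw [← h4]; positivity
  have hc0 : 0 ≤ c := by positivity
  rw [h1, h2, h3, h4]
  obtain hc' | hc' := hc0.eq_or_lt
  · have : b = 0 := by rw [← hc'] at hbc; exact abs_nonpos_iff.mp hbc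
    rw [this, ← hc']
  have hconv : ConvexOn ℝ (Ici (0 : ℝ)) fun s : ℝ => s ^ k := convexOn_pow k
  obtain ⟨hb1, hb2⟩ := abs_le.mp hbc
  -- These weights write `a + b` as a convex combination of `a ± c`; exchanged, they give `a - b`.
  have hw1 : 0 ≤ (c + b) / (2 * c) := div_nonneg (by linarith) (by linarith)
  have hw2 : 0 ≤ (c - b) / (2 * c) := div_nonneg (by linarith) (by linarith)
  have hw : (c + b) / (2 * c) + (c - b) / (2 * c) = 1 := by field_simp; ring
  have hP : a + c ∈ Ici (0 : ℝ) := by rw [mem_Ici]; linarith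
  have hM : a - c ∈ Ici (0 : ℝ) := hca
  have e1 := hconv.2 hP hM hw1 hw2 hw
  have e2 := hconv.2 hP hM hw2 hw1 (by rw [add_comm]; exact hw)
  simp only [smul_eq_mul] at e1 e2
  have f1 : (c + b) / (2 * c) * (a + c) + (c - b) / (2 * c) * (a - c) = a + b := by
    field_simp; ring
  have f2 : (c - b) / (2 * c) * (a + c) + (c + b) / (2 * c) * (a - c) = a - b := by
    field_simp; ring
  rw [f1] at e1
  rw [f2] at e2
  have : (c + b) / (2 * c) = 1 - (c - b) / (2 * c) := by linarith
  rw [this] at e1 e2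
  linarith

/-- Induction on `n`: summing over the first sign splits off one factor by the two-point inequality.
-/
theorem sum_cosh_norm_signedSum_le (n : ℕ) (v : Fin n → Z) :
    ∑ τ : Fin n → Bool, Real.cosh ‖signedSum τ v‖ ≤ 2 ^ n * ∏ i, Real.cosh ‖v i‖ := by
  induction n with
  | zero => simp [signedSum]
  | succ n ih =>
    rw [← (Fin.consEquiv fun _ : Fin (n + 1) => Bool).sum_comp, Fintype.sum_prod_type,
      Fintype.sum_bool, ← Finset.sum_add_distrib, Fin.prod_univ_succ]
    calc _ ≤ ∑ τ : Fin n → Bool,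
          2 * (Real.cosh ‖signedSum τ fun i => v i.succ‖ * Real.cosh ‖v 0‖) := by
          refine Finset.sum_le_sum fun τ _ => ?_
          refine le_trans (le_of_eq ?_) (cosh_norm_add_add_cosh_norm_sub_le _ _)
          simp [signedSum, Fin.sum_univ_succ, boolSign, Fin.consEquiv, add_comm, sub_eq_add_neg]
      _ = 2 * Real.cosh ‖v 0‖ * ∑ τ : Fin n → Bool, Real.cosh ‖signedSum τ fun i => v i.succ‖ := by
          rw [Finset.mul_sum]; exact Finset.sum_congr rfl fun τ _ => by ring
      _ ≤ 2 * Real.cosh ‖v 0‖ * (2 ^ n * ∏ i : Fin n, Real.cosh ‖v i.succ‖) :=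
          mul_le_mul_of_nonneg_left (ih _) (by positivity)
      _ = _ := by ring

theorem sum_cosh_mul_norm_signedSum_le {n : ℕ} (l : ℝ) (v : PiLp 2 fun _ : Fin n => Z) :
    ∑ τ : Fin n → Bool, Real.cosh (l * ‖signedSum τ v‖)
      ≤ 2 ^ n * Real.exp (l ^ 2 * ‖v‖ ^ 2 / 2) := by
  calc _ = ∑ τ : Fin n → Bool, Real.cosh ‖signedSum τ (l • (v : Fin n → Z))‖ := by
        refine Finset.sum_congr rfl fun τ _ => ?_
        rw [signedSum_smul, norm_smul, Real.norm_eq_abs, ← Real.cosh_abs, abs_mul, abs_norm]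
    _ ≤ 2 ^ n * ∏ i, Real.cosh ‖(l • (v : Fin n → Z)) i‖ := sum_cosh_norm_signedSum_le n _
    _ ≤ 2 ^ n * ∏ i, Real.exp (‖(l • (v : Fin n → Z)) i‖ ^ 2 / 2) := by
        refine mul_le_mul_of_nonneg_left (Finset.prod_le_prod (fun i _ => (Real.cosh_pos _).le)
          fun i _ => Real.cosh_le_exp_half_sq _) (by positivity)
    _ = _ := by
        rw [← Real.exp_sum, PiLp.norm_sq_eq_of_L2, ← Finset.sum_div, Finset.mul_sum]
        simp [norm_smul, mul_pow]

/-- Maximal inequality for signed sums of finitely many families of vectors in a Hilbert space. -/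
theorem exists_signedSum_maximal {n : ℕ} (C : Finset (PiLp 2 fun _ : Fin n => Z)) (b s : ℝ)
    (hb : 0 ≤ b) (hs : 0 ≤ s) (hcard : (C.card : ℝ) ≤ Real.exp b) (hC : ∀ c ∈ C, ‖c‖ ≤ s) :
    ∃ W : (Fin n → Bool) → ℝ, (∀ τ, ∀ c ∈ C, ‖signedSum τ c‖ ≤ W τ) ∧
      ∑ τ, W τ ≤ 2 ^ n * (s * Real.sqrt (2 * (Real.log 2 + b))) := by
  obtain rfl | hs := hs.eq_or_lt
  · refine ⟨fun _ => 0, fun τ c hc => ?_, by simp⟩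
    have : c = 0 := norm_le_zero_iff.mp (hC c hc)
    simp [this, signedSum]
  have hlog : 0 < Real.log 2 := Real.log_pos one_lt_two
  set q := Real.sqrt (2 * (Real.log 2 + b)) with hq
  have hq0 : 0 < q := Real.sqrt_pos.mpr (by linarith)
  have hq2 : q ^ 2 = 2 * (Real.log 2 + b) := Real.sq_sqrt (by linarith)
  -- This `l` minimises the final bound `a / l`: it makes `l² s² / 2 = log 2 + b`, hence `a = q² = l
  -- s q`.
  set l := q / s with hl
  have hl0 : 0 < l := div_pos hq0 hs
  set a := Real.log 2 + b + l ^ 2 * s ^ 2 / 2 with ha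
  have ha' : a = l * (s * q) := by
    have e1 : l * s = q := div_mul_cancel₀ _ hs.ne'
    have : l ^ 2 * s ^ 2 = q ^ 2 := by rw [← mul_pow, e1]
    rw [ha, this, ← mul_assoc, e1, ← sq, hq2]; ring
  -- The tangent-line bound `y ≤ a - 1 + exp (y - a)` replaces Jensen's inequality for the
  -- logarithm. It gives a majorant for each `τ` that can be summed directly.
  refine ⟨fun τ => l⁻¹ * (a - 1 + Real.exp (-a) *
    ∑ c ∈ C, 2 * Real.cosh (l * ‖signedSum τ c‖)), fun τ c hc => ?_, ?_⟩
  · have h1 : Real.exp (l * ‖signedSum τ c‖) ≤ ∑ c ∈ C, 2 * Real.cosh (l * ‖signedSum τ c‖) := by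
      refine le_trans ?_ (Finset.single_le_sum
        (f := fun c : PiLp 2 fun _ : Fin n => Z => 2 * Real.cosh (l * ‖signedSum τ c‖))
        (fun c _ => by positivity) hc)
      simp only [Real.cosh_eq]
      have := Real.exp_pos (-(l * ‖signedSum τ c‖))
      linarith
    have h2 := Real.add_one_le_exp (l * ‖signedSum τ c‖ - a)
    rw [sub_eq_add_neg, Real.exp_add] at h2
    have h3 := mul_le_mul_of_nonneg_left h1 (Real.exp_pos (-a)).le
    rw [le_inv_mul_iff₀ hl0]
    linarith
  · rw [← Finset.mul_sum, Finset.sum_add_distrib, ← Finset.mul_sum, Finset.sum_comm,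
      inv_mul_le_iff₀ hl0]
    have h1 : ∑ c ∈ C, ∑ τ : Fin n → Bool, 2 * Real.cosh (l * ‖signedSum τ c‖)
        ≤ 2 ^ n * Real.exp a := by
      calc _ ≤ ∑ c ∈ C, 2 * (2 ^ n * Real.exp (l ^ 2 * s ^ 2 / 2)) := by
            refine Finset.sum_le_sum fun c hc => ?_
            rw [← Finset.mul_sum]
            refine mul_le_mul_of_nonneg_left
              ((sum_cosh_mul_norm_signedSum_le l c).trans ?_) zero_le_two
            have := hC c hc
            gcongr
        _ = C.card * (2 * (2 ^ n * Real.exp (l ^ 2 * s ^ 2 / 2))) := by simp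
        _ ≤ Real.exp b * (2 * (2 ^ n * Real.exp (l ^ 2 * s ^ 2 / 2))) := by gcongr
        _ = _ := by
            rw [ha, Real.exp_add, Real.exp_add, Real.exp_log zero_lt_two]; ring
    have h2 := mul_le_mul_of_nonneg_left h1 (Real.exp_pos (-a)).le
    have h3 : Real.exp (-a) * (2 ^ n * Real.exp a) = 2 ^ n := by
      rw [mul_left_comm, ← Real.exp_add]; simp
    rw [h3] at h2
    have h4 : ∑ τ : Fin n → Bool, (a - 1) = 2 ^ n * (a - 1) := by simp [mul_sub]
    rw [h4]
    have : l * (2 ^ n * (s * q)) = 2 ^ n * a := by rw [ha']; ring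
    rw [this]
    linarith

end Rademacher
-- Dudley chaining.
section Chaining

variable {Z : Type*} [NormedAddCommGroup Z] [InnerProductSpace ℝ Z]

theorem sqrt_two_mul_log_two_add_le {b : ℝ} (hb : 0 ≤ b) :
    Real.sqrt (2 * (Real.log 2 + b)) ≤ 2 * (1 + Real.sqrt b) := by
  refine Real.sqrt_le_iff.mpr ⟨by positivity, ?_⟩
  have h1 := Real.sq_sqrt hb
  have h2 := Real.log_two_lt_d9
  nlinarith [Real.sqrt_nonneg b]

theorem sqrt_two_mul_log_two_add_two_mul_le {b : ℝ} (hb : 0 ≤ b) :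
    Real.sqrt (2 * (Real.log 2 + 2 * b)) ≤ 2 * (1 + Real.sqrt b) := by
  refine Real.sqrt_le_iff.mpr ⟨by positivity, ?_⟩
  have h1 := Real.sq_sqrt hb
  have h2 := Real.log_two_lt_d9
  nlinarith [Real.sqrt_nonneg b]

/-- Dudley's chaining bound for signed sums of vectors in a Hilbert space, started at the
level `k₀`. -/
theorem sum_iSup_signedSum_le {n : ℕ} (T : Set (PiLp 2 fun _ : Fin n => Z))
    (C : ℕ → Finset (PiLp 2 fun _ : Fin n => Z)) (b : ℕ → ℝ) (hb : ∀ k, 0 ≤ b k)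
    (hmono : Monotone b) {r R : ℝ} (hr : 0 ≤ r) (hR : 0 ≤ R)
    (hC : ∀ k, ∀ t ∈ T, ∃ c ∈ C k, ‖t - c‖ ≤ (1 / 2) ^ k * r)
    (hcard : ∀ k, ((C k).card : ℝ) ≤ Real.exp (b k)) (hT : ∀ t ∈ T, ‖t‖ ≤ R)
    (hsum : Summable fun k => (1 / 2 : ℝ) ^ k * (1 + Real.sqrt (b k))) (k₀ : ℕ) :
    ∑ τ : Fin n → Bool, ⨆ t ∈ T, ‖signedSum τ t‖ₑ ≤ 2 ^ n * ENNReal.ofReal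
      (2 * (1 + Real.sqrt (b k₀)) * R
        + 6 * r * ∑' k, (1 / 2 : ℝ) ^ (k + k₀) * (1 + Real.sqrt (b (k + k₀)))) := by
  classical
  set s : ℕ → ℝ := fun k => (1 / 2 : ℝ) ^ k * (1 + Real.sqrt (b k)) with hs
  have hs0 : ∀ k, 0 ≤ s k := fun k => by positivity
  -- Only centres within `2⁻ᵏ⁰ r` of a point of `T` start a chain, so the others may be discarded.
  obtain ⟨W₀, hW₀, hW₀s⟩ := exists_signedSum_maximal
    ((C k₀).filter fun c => ‖c‖ ≤ R + (1 / 2) ^ k₀ * r) (b k₀) (R + (1 / 2) ^ k₀ * r) (hb _)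
    (by positivity) (le_trans (by exact_mod_cast Finset.card_filter_le _ _) (hcard k₀))
    (fun c hc => (Finset.mem_filter.mp hc).2)
  have hlink : ∀ k, ∃ W : (Fin n → Bool) → ℝ,
      (∀ τ, ∀ c ∈ C k, ∀ c' ∈ C (k + 1), ‖c' - c‖ ≤ 3 * (1 / 2) ^ (k + 1) * r →
        ‖signedSum τ (c' - c)‖ ≤ W τ) ∧ ∑ τ, W τ ≤ 2 ^ n * (6 * r * s (k + 1)) := by
    intro k
    -- Links join centres of consecutive levels: at most `exp (b k + b (k + 1))` pairs, of length at
    -- most `2⁻ᵏ r + 2⁻⁽ᵏ⁺¹⁾ r = 3 · 2⁻⁽ᵏ⁺¹⁾ r`.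
    have hcardk : (((((C k ×ˢ C (k + 1)).image fun p => p.2 - p.1).filter
        fun c => ‖c‖ ≤ 3 * (1 / 2) ^ (k + 1) * r).card : ℕ) : ℝ) ≤ Real.exp (2 * b (k + 1)) := by
      calc _ ≤ (((C k ×ˢ C (k + 1)).card : ℕ) : ℝ) := by
            exact_mod_cast (Finset.card_filter_le _ _).trans Finset.card_image_le
        _ = (C k).card * (C (k + 1)).card := by rw [Finset.card_product]; push_cast; rfl
        _ ≤ Real.exp (b k) * Real.exp (b (k + 1)) := by
            gcongr
            · exact hcard k
            · exact hcard (k + 1)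
        _ ≤ Real.exp (b (k + 1)) * Real.exp (b (k + 1)) := by
            gcongr
            exact hmono (Nat.le_succ k)
        _ = _ := by rw [← Real.exp_add]; ring_nf
    obtain ⟨W, hW, hWs⟩ := exists_signedSum_maximal
      (((C k ×ˢ C (k + 1)).image fun p => p.2 - p.1).filter
        fun c => ‖c‖ ≤ 3 * (1 / 2) ^ (k + 1) * r) (2 * b (k + 1)) (3 * (1 / 2) ^ (k + 1) * r)
      (mul_nonneg zero_le_two (hb _)) (by positivity) hcardk (fun c hc => (Finset.mem_filter.mp hc).2)
    · refine ⟨W, fun τ c hc c' hc' hcc => hW τ (c' - c) ?_, hWs.trans ?_⟩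
      · exact Finset.mem_filter.mpr ⟨Finset.mem_image.mpr
          ⟨(c, c'), Finset.mem_product.mpr ⟨hc, hc'⟩, rfl⟩, hcc⟩
      · refine mul_le_mul_of_nonneg_left ?_ (by positivity)
        calc _ ≤ 3 * (1 / 2) ^ (k + 1) * r * (2 * (1 + Real.sqrt (b (k + 1)))) :=
              mul_le_mul_of_nonneg_left (sqrt_two_mul_log_two_add_two_mul_le (hb _))
                (by positivity)
          _ = _ := by simp only [hs]; ring
  choose W hW hWs using hlink
  -- The chain stops at level `k₀ + m`. The remainder is bounded crudely with a factor `n`, which is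
  -- harmless since `n` is fixed while `m → ∞`.
  have hpt : ∀ (m : ℕ) (τ : Fin n → Bool), ∀ t ∈ T, ‖signedSum τ t‖ ≤
      W₀ τ + ∑ j ∈ Finset.range m, W (k₀ + j) τ + n * ((1 / 2) ^ (k₀ + m) * r) := by
    intro m τ t ht
    choose c hc hct using fun k => hC k t ht
    have h1 : ∀ m, ‖signedSum τ (c (k₀ + m))‖ ≤ W₀ τ + ∑ j ∈ Finset.range m, W (k₀ + j) τ := by
      intro m
      induction m with
      | zero =>
        simp only [add_zero, Finset.range_zero, Finset.sum_empty]
        refine hW₀ τ _ (Finset.mem_filter.mpr ⟨hc k₀, ?_⟩)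
        have e : c k₀ = t - (t - c k₀) := by abel
        rw [e]
        exact (norm_sub_le _ _).trans (add_le_add (hT t ht) (hct k₀))
      | succ m ih =>
        have e : c (k₀ + m + 1) = c (k₀ + m) + (c (k₀ + m + 1) - c (k₀ + m)) := by abel
        rw [Finset.sum_range_succ, ← add_assoc, ← add_assoc, e, WithLp.ofLp_add, signedSum_add]
        refine (norm_add_le _ _).trans (add_le_add ih
          (hW (k₀ + m) τ _ (hc _) _ (hc _) ?_))
        have e2 : c (k₀ + m + 1) - c (k₀ + m) = (t - c (k₀ + m)) - (t - c (k₀ + m + 1)) := by abel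
        rw [e2]
        refine (norm_sub_le _ _).trans ((add_le_add (hct _) (hct _)).trans (le_of_eq ?_))
        ring
    have e : t = c (k₀ + m) + (t - c (k₀ + m)) := by abel
    rw [e, WithLp.ofLp_add, signedSum_add]
    refine (norm_add_le _ _).trans (add_le_add (h1 m) ((norm_signedSum_le τ _).trans ?_))
    exact mul_le_mul_of_nonneg_left (hct _) (Nat.cast_nonneg n)
  have hsum' : Summable fun k => s (k + k₀) := (summable_nat_add_iff k₀).mpr hsum
  set B := 2 * (1 + Real.sqrt (b k₀)) * R + 6 * r * ∑' k, s (k + k₀) with hB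
  have hm : ∀ m : ℕ, ∑ τ : Fin n → Bool, ⨆ t ∈ T, ‖signedSum τ t‖ₑ
      ≤ ENNReal.ofReal (2 ^ n * (B + n * ((1 / 2) ^ (k₀ + m) * r))) := by
    intro m
    rcases T.eq_empty_or_nonempty with rfl | ⟨t₀, ht₀⟩
    · simp
    calc _ ≤ ∑ τ : Fin n → Bool, ENNReal.ofReal (W₀ τ + ∑ j ∈ Finset.range m, W (k₀ + j) τ
          + n * ((1 / 2) ^ (k₀ + m) * r)) := by
          refine Finset.sum_le_sum fun τ _ => iSup₂_le fun t ht => ?_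
          rw [← ofReal_norm]
          exact ENNReal.ofReal_le_ofReal (hpt m τ t ht)
      _ = ENNReal.ofReal (∑ τ : Fin n → Bool, (W₀ τ + ∑ j ∈ Finset.range m, W (k₀ + j) τ
          + n * ((1 / 2) ^ (k₀ + m) * r))) :=
          (ENNReal.ofReal_sum_of_nonneg fun τ _ => (norm_nonneg _).trans (hpt m τ t₀ ht₀)).symm
      _ ≤ _ := by
          refine ENNReal.ofReal_le_ofReal ?_
          rw [Finset.sum_add_distrib, Finset.sum_add_distrib, Finset.sum_comm, mul_add]
          refine add_le_add ?_ (le_of_eq (by simp))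
          calc _ ≤ 2 ^ n * (2 * (1 + Real.sqrt (b k₀)) * R + 6 * r * s k₀)
                + ∑ j ∈ Finset.range m, 2 ^ n * (6 * r * s (k₀ + j + 1)) := by
                refine add_le_add (hW₀s.trans ?_) (Finset.sum_le_sum fun j _ => hWs _)
                refine mul_le_mul_of_nonneg_left ?_ (by positivity)
                refine (mul_le_mul_of_nonneg_left (sqrt_two_mul_log_two_add_le (hb k₀))
                  (by positivity)).trans ?_
                -- The approximation error at the start costs `2 r s k₀ ≤ 6 r s k₀`, the missing
                -- first term of the tail sum.
                have : 0 ≤ r * s k₀ := mul_nonneg hr (hs0 _)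
                have e : (R + (1 / 2) ^ k₀ * r) * (2 * (1 + Real.sqrt (b k₀)))
                    = 2 * (1 + Real.sqrt (b k₀)) * R + 2 * (r * s k₀) := by
                  simp only [hs]; ring
                rw [e]
                linarith
            _ = 2 ^ n * (2 * (1 + Real.sqrt (b k₀)) * R
                + 6 * r * ∑ j ∈ Finset.range (m + 1), s (j + k₀)) := by
                rw [Finset.sum_range_succ', ← Finset.mul_sum, ← Finset.mul_sum, zero_add]
                have : ∀ j, s (k₀ + j + 1) = s (j + 1 + k₀) := fun j => by congr 1; ring
                simp only [this]
                ring
            _ ≤ _ := by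
                rw [hB]
                gcongr
                exact hsum'.sum_le_tsum _ fun j _ => hs0 _
  have hlim : Tendsto (fun m : ℕ => ENNReal.ofReal
      (2 ^ n * (B + n * ((1 / 2) ^ (k₀ + m) * r)))) atTop (𝓝 (ENNReal.ofReal (2 ^ n * B))) := by
    refine ENNReal.tendsto_ofReal ?_
    have h0 : Tendsto (fun m : ℕ => (1 / 2 : ℝ) ^ (k₀ + m)) atTop (𝓝 0) := by
      simp only [pow_add]
      simpa using (tendsto_pow_atTop_nhds_zero_of_lt_one (r := (1 / 2 : ℝ)) (by norm_num)
        (by norm_num)).const_mul ((1 / 2 : ℝ) ^ k₀)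
    simpa using (((h0.mul_const r).const_mul (n : ℝ)).const_add B).const_mul ((2 : ℝ) ^ n)
  refine (ge_of_tendsto' hlim hm).trans (le_of_eq ?_)
  rw [ENNReal.ofReal_mul (by positivity)]
  simp [ENNReal.ofReal_pow]

end Chaining
-- Symmetrisation with a ghost sample.
section Symmetrization

theorem measurePreserving_reindex {S ι κ : Type*} [Fintype ι] [Fintype κ] [MeasurableSpace S]
    (P : Measure S) [IsProbabilityMeasure P] (e : κ ≃ ι) :
    MeasurePreserving (fun (z : ι → S) k => z (e k)) (Measure.pi fun _ => P)
      (Measure.pi fun _ => P) where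
  measurable := measurable_pi_lambda _ fun k => measurable_pi_apply (e k)
  map_eq := by
    refine (Measure.pi_eq fun s hs => ?_).symm
    have h : (fun (z : ι → S) k => z (e k)) ⁻¹' univ.pi s = univ.pi fun i => s (e.symm i) := by
      ext z
      simp only [mem_preimage, mem_univ_pi]
      exact ⟨fun h i => by simpa using h (e.symm i), fun h k => by simpa using h (e k)⟩
    rw [Measure.map_apply (measurable_pi_lambda _ fun k => measurable_pi_apply (e k))
      (MeasurableSet.univ_pi hs), h, Measure.pi_pi, e.symm.prod_comp fun k => P (s k)]

/-- The value `∞` on a measurable null set makes the bound hold everywhere, as is needed to control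
every sample rather than almost every one. -/
theorem exists_measurable_ge_ae_eq {α : Type*} [MeasurableSpace α] {μ : Measure α}
    {f : α → ℝ≥0∞} (hf : AEMeasurable f μ) :
    ∃ g, Measurable g ∧ (∀ a, f a ≤ g a) ∧ f =ᵐ[μ] g := by
  classical
  set N := toMeasurable μ {a | f a ≠ hf.mk f a} with hN
  have hN0 : μ N = 0 := by rw [hN, measure_toMeasurable]; exact hf.ae_eq_mk
  refine ⟨N.piecewise (fun _ => ⊤) (hf.mk f),
    measurable_const.piecewise (measurableSet_toMeasurable _ _) hf.measurable_mk,
    fun a => ?_, ?_⟩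
  · by_cases ha : a ∈ N
    · simp [ha]
    · have : f a = hf.mk f a := by
        by_contra h
        exact ha (subset_toMeasurable μ _ h)
      simp [ha, ← this]
  · filter_upwards [hf.ae_eq_mk, measure_eq_zero_iff_ae_notMem.mp hN0] with a h1 h2
    simp [h2, h1]

/-- The permutation of two copies of `Fin n` that exchanges the two copies of `i` when `τ i` is
false. -/
def swapPerm {n : ℕ} (τ : Fin n → Bool) : Equiv.Perm (Fin n ⊕ Fin n) :=
  Function.Involutive.toPerm
    (Sum.elim (fun i => if τ i then Sum.inl i else Sum.inr i)
      (fun i => if τ i then Sum.inr i else Sum.inl i)) (by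
    rintro (i | i) <;> cases h : τ i <;> simp [h])

theorem swapPerm_inl {n : ℕ} (τ : Fin n → Bool) (i : Fin n) :
    swapPerm τ (Sum.inl i) = if τ i then Sum.inl i else Sum.inr i := rfl

theorem swapPerm_inr {n : ℕ} (τ : Fin n → Bool) (i : Fin n) :
    swapPerm τ (Sum.inr i) = if τ i then Sum.inr i else Sum.inl i := rfl

variable {S Z : Type*} [MeasurableSpace S] [NormedAddCommGroup Z] [NormedSpace ℝ Z]

/-- Exchanging `xᵢ` and `yᵢ` preserves the product measure and flips the `i`-th sign, so the
integral does not depend on `τ`. Measurability comes from the hypothesis at sample size `2n`, with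
`n` signs of each kind. -/
theorem exists_lintegral_iSup_signed_difference (P : Measure S) [IsProbabilityMeasure P]
    {F : Set (S → Z)} (hF : MeasurableSuprema P F) (n : ℕ) :
    ∃ I : ℝ≥0∞, ∀ τ : Fin n → Bool,
      AEMeasurable (fun p : (Fin n → S) × (Fin n → S) =>
        ⨆ f ∈ F, ‖signedSum τ fun i => f (p.1 i) - f (p.2 i)‖ₑ)
        ((Measure.pi fun _ => P).prod (Measure.pi fun _ => P)) ∧
      ∫⁻ p, (⨆ f ∈ F, ‖signedSum τ fun i => f (p.1 i) - f (p.2 i)‖ₑ)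
        ∂((Measure.pi fun _ : Fin n => P).prod (Measure.pi fun _ : Fin n => P)) = I := by
  set σ : Fin (n + n) → ℝ := fun k => Sum.elim (fun _ => 1) (fun _ => -1) (finSumFinEquiv.symm k)
    with hσ
  have hσ' : ∀ k, σ k = 1 ∨ σ k = -1 := by
    intro k
    rcases h : finSumFinEquiv.symm k with i | i <;> simp [hσ, h]
  have hU := hF (n + n) σ hσ'
  refine ⟨∫⁻ x, (⨆ f ∈ F, ‖∑ i, σ i • f (x i)‖ₑ) ∂(Measure.pi fun _ : Fin (n + n) => P),
    fun τ => ?_⟩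
  have h1 := (measurePreserving_sumPiEquivProdPi_symm
    (X := fun _ : Fin n ⊕ Fin n => S) fun _ => P)
  have h2 := (measurePreserving_reindex P
    ((finSumFinEquiv.symm : Fin (n + n) ≃ Fin n ⊕ Fin n).trans (swapPerm τ))).comp h1
  have heq : ∀ p : (Fin n → S) × (Fin n → S),
      (⨆ f ∈ F, ‖signedSum τ fun i => f (p.1 i) - f (p.2 i)‖ₑ) =
      (fun x : Fin (n + n) → S => ⨆ f ∈ F, ‖∑ i, σ i • f (x i)‖ₑ)
        (((fun (z : Fin n ⊕ Fin n → S) k =>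
          z (((finSumFinEquiv.symm : Fin (n + n) ≃ Fin n ⊕ Fin n).trans (swapPerm τ)) k)) ∘
          (MeasurableEquiv.sumPiEquivProdPi fun _ : Fin n ⊕ Fin n => S).symm) p) := by
    rintro ⟨x, y⟩
    refine iSup_congr fun f => iSup_congr fun _ => ?_
    congr 1
    rw [← (finSumFinEquiv : Fin n ⊕ Fin n ≃ Fin (n + n)).sum_comp, Fintype.sum_sum_type,
      ← Finset.sum_add_distrib, signedSum]
    refine Finset.sum_congr rfl fun i _ => ?_
    simp only [hσ, Function.comp_apply, Equiv.symm_apply_apply, Equiv.trans_apply, Sum.elim_inl,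
      Sum.elim_inr, swapPerm_inl, swapPerm_inr]
    cases τ i <;> simp [boolSign, MeasurableEquiv.sumPiEquivProdPi, Equiv.sumPiEquivProdPi,
      sub_eq_add_neg, add_comm]
  constructor
  · simp only [heq]
    exact hU.comp_quasiMeasurePreserving h2.quasiMeasurePreserving
  · have hU2 := hU
    rw [← h2.map_eq] at hU2
    refine (lintegral_congr heq).trans
      ((lintegral_map' hU2 h2.measurable.aemeasurable).symm.trans ?_)
    rw [h2.map_eq]

/-- Symmetrisation: the supremum of the centred sums has a measurable majorant whose integral is
at most twice the average over signs of the suprema of the signed sums. -/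
theorem exists_centered_majorant [CompleteSpace Z] (P : Measure S) [IsProbabilityMeasure P]
    {F : Set (S → Z)} (hF : MeasurableSuprema P F) (hint : ∀ f ∈ F, Integrable f P) (n : ℕ)
    (φ : (Fin n → S) → ℝ≥0∞)
    (hφ : ∀ x, ∑ τ : Fin n → Bool, ⨆ f ∈ F, ‖signedSum τ fun i => f (x i)‖ₑ ≤ 2 ^ n * φ x) :
    ∃ h : (Fin n → S) → ℝ≥0∞, Measurable h ∧
      (∀ x, ∀ f ∈ F, ‖∑ i, f (x i) - (n : ℝ) • ∫ s, f s ∂P‖ₑ ≤ h x) ∧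
      ∫⁻ x, h x ∂(Measure.pi fun _ => P) ≤ 2 * ∫⁻ x, φ x ∂(Measure.pi fun _ => P) := by
  obtain ⟨I, hI⟩ := exists_lintegral_iSup_signed_difference P hF n
  set Pn := Measure.pi fun _ : Fin n => P with hPn
  obtain ⟨hD, hDI⟩ := hI fun _ => true
  -- Centring is integration over the ghost sample `y`. Integrating `V` over `y` therefore dominates
  -- the centred sum for every `x`.
  obtain ⟨V, hV, hVge, hVae⟩ := exists_measurable_ge_ae_eq hD
  refine ⟨fun x => ∫⁻ y, V (x, y) ∂Pn, hV.lintegral_prod_right', fun x f hf => ?_, ?_⟩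
  · have hev : ∀ i : Fin n, Integrable (fun y : Fin n → S => f (y i)) Pn := fun i =>
      integrable_comp_eval (hint f hf)
    have hfi : ∀ i : Fin n, ∫ y : Fin n → S, f (y i) ∂Pn = ∫ s, f s ∂P := fun i =>
      integral_comp_eval (hint f hf).aestronglyMeasurable
    have h1 : ∑ i, f (x i) - (n : ℝ) • ∫ s, f s ∂P
        = ∫ y, signedSum (fun _ => true) (fun i => f (x i) - f (y i)) ∂Pn := by
      simp only [signedSum, boolSign, if_true, one_smul]
      have hsub : ∀ i : Fin n, Integrable (fun y : Fin n → S => f (x i) - f (y i)) Pn :=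
        fun i => (integrable_const _).sub (hev i)
      rw [integral_finsetSum _ fun i _ => hsub i]
      have : ∀ i : Fin n, ∫ y : Fin n → S, (f (x i) - f (y i)) ∂Pn = f (x i) - ∫ s, f s ∂P := by
        intro i
        rw [integral_sub (integrable_const _) (hev i), hfi i]
        simp
      simp only [this, Finset.sum_sub_distrib]
      simp [Nat.cast_smul_eq_nsmul]
    rw [h1]
    refine (enorm_integral_le_lintegral_enorm _).trans (lintegral_mono fun y => ?_)
    refine le_trans ?_ (hVge (x, y))
    exact le_iSup₂ (f := fun (f : S → Z) (_ : f ∈ F) =>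
      ‖signedSum (fun _ => true) fun i => f (x i) - f (y i)‖ₑ) f hf
  · have hA : ∀ τ : Fin n → Bool,
        AEMeasurable (fun x : Fin n → S => ⨆ f ∈ F, ‖signedSum τ fun i => f (x i)‖ₑ) Pn :=
      fun τ => hF n (fun i => boolSign (τ i)) fun i => boolSign_eq (τ i)
    have hIle : ∀ τ : Fin n → Bool,
        I ≤ 2 * ∫⁻ x, (⨆ f ∈ F, ‖signedSum τ fun i => f (x i)‖ₑ) ∂Pn := by
      intro τ
      rw [← (hI τ).2]
      have hfst : AEMeasurable (fun p : (Fin n → S) × (Fin n → S) =>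
          ⨆ f ∈ F, ‖signedSum τ fun i => f (p.1 i)‖ₑ) (Pn.prod Pn) := (hA τ).comp_quasiMeasurePreserving
        (Measure.quasiMeasurePreserving_fst (μ := Pn) (ν := Pn))
      calc _ ≤ ∫⁻ p : (Fin n → S) × (Fin n → S),
            ((⨆ f ∈ F, ‖signedSum τ fun i => f (p.1 i)‖ₑ)
              + ⨆ f ∈ F, ‖signedSum τ fun i => f (p.2 i)‖ₑ) ∂(Pn.prod Pn) := by
            refine lintegral_mono fun p => iSup₂_le fun f hf => ?_
            have e : signedSum τ (fun i => f (p.1 i) - f (p.2 i))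
                = signedSum τ (fun i => f (p.1 i)) - signedSum τ fun i => f (p.2 i) := by
              simp [signedSum, smul_sub]
            rw [e]
            refine enorm_sub_le.trans (add_le_add ?_ ?_)
            · exact le_iSup₂ (f := fun (f : S → Z) (_ : f ∈ F) =>
                ‖signedSum τ fun i => f (p.1 i)‖ₑ) f hf
            · exact le_iSup₂ (f := fun (f : S → Z) (_ : f ∈ F) =>
                ‖signedSum τ fun i => f (p.2 i)‖ₑ) f hf
        _ = _ := by
            rw [lintegral_add_left' hfst]
            have m1 := (measurePreserving_fst (μ := Pn) (ν := Pn))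
            have m2 := (measurePreserving_snd (μ := Pn) (ν := Pn))
            have e1 := lintegral_map' (f := fun x : Fin n → S =>
              ⨆ f ∈ F, ‖signedSum τ fun i => f (x i)‖ₑ) (μ := Pn.prod Pn) (g := Prod.fst)
              (by rw [m1.map_eq]; exact hA τ) m1.measurable.aemeasurable
            have e2 := lintegral_map' (f := fun x : Fin n → S =>
              ⨆ f ∈ F, ‖signedSum τ fun i => f (x i)‖ₑ) (μ := Pn.prod Pn) (g := Prod.snd)
              (by rw [m2.map_eq]; exact hA τ) m2.measurable.aemeasurable
            rw [m1.map_eq] at e1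
            rw [m2.map_eq] at e2
            rw [two_mul, e1]
            congr 1
            rw [← e1, e2]
    -- Since `I` is the same for all `τ`, the bounds can be averaged over all sign patterns.
    have h1 : 2 ^ n * I ≤ 2 ^ n * (2 * ∫⁻ x, φ x ∂Pn) := by
      calc 2 ^ n * I = ∑ τ : Fin n → Bool, I := by simp
        _ ≤ ∑ τ : Fin n → Bool, 2 * ∫⁻ x, (⨆ f ∈ F, ‖signedSum τ fun i => f (x i)‖ₑ) ∂Pn :=
            Finset.sum_le_sum fun τ _ => hIle τ
        _ = 2 * ∫⁻ x, ∑ τ : Fin n → Bool, (⨆ f ∈ F, ‖signedSum τ fun i => f (x i)‖ₑ) ∂Pn := by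
            rw [lintegral_finsetSum' _ fun τ _ => hA τ, Finset.mul_sum]
        _ ≤ 2 * ∫⁻ x, 2 ^ n * φ x ∂Pn := by gcongr with x; exact hφ x
        _ = _ := by
            rw [lintegral_const_mul' _ _ (by finiteness)]; ring
    rw [← lintegral_prod _ hV.aemeasurable, ← lintegral_congr_ae hVae, hDI]
    exact (ENNReal.mul_le_mul_iff_right (by positivity) (by finiteness)).mp h1

end Symmetrization
-- Covering numbers of empirical distributions and the dyadic entropy sum.
section Covering

variable {S Y : Type*} [NormedAddCommGroup Y]

/-- The empirical distribution of a sample of positive size. -/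
noncomputable def empiricalPMF {n : ℕ} [NeZero n] (x : Fin n → S) : PMF S :=
  (PMF.uniformOfFintype (Fin n)).map x

theorem empiricalPMF_support_finite {n : ℕ} [NeZero n] (x : Fin n → S) :
    (empiricalPMF x).support.Finite := by
  rw [empiricalPMF, PMF.support_map]
  exact (toFinite _).image x

theorem discreteL2_empiricalPMF {n : ℕ} [NeZero n] (x : Fin n → S) (g : S → Y) :
    discreteL2 (empiricalPMF x) g = Real.sqrt ((n : ℝ)⁻¹ * ∑ i, ‖g (x i)‖ ^ 2) := by
  classical
  rw [discreteL2]
  congr 1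
  have hmass : ∀ s, (empiricalPMF x s).toReal = ∑ i, if s = x i then (n : ℝ)⁻¹ else 0 := by
    intro s
    rw [empiricalPMF, PMF.map_apply, tsum_fintype, ENNReal.toReal_sum]
    · refine Finset.sum_congr rfl fun i _ => ?_
      split_ifs <;> simp
    · intro i _
      split_ifs <;> simp [NeZero.ne n]
  rw [tsum_eq_sum (s := Finset.univ.image x)]
  · simp only [hmass, Finset.sum_mul, Finset.mul_sum]
    rw [Finset.sum_comm]
    refine Finset.sum_congr rfl fun i _ => ?_
    rw [Finset.sum_eq_single (x i)]
    · simp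
    · intro s _ hs
      simp [hs]
    · intro h
      exact absurd (Finset.mem_image_of_mem x (Finset.mem_univ i)) h
  · intro s hs
    have : ∀ i, s ≠ x i := fun i h => hs (h ▸ Finset.mem_image_of_mem x (Finset.mem_univ i))
    simp [hmass, this]

/-- A real bound on the logarithm makes the covering number finite, and an infimum in `ℕ∞` is
attained. -/
theorem exists_finset_of_entropyL2_le {r h : ℝ} {𝒢 : Set (S → Y)} {Q : PMF S}
    (hN : entropyL2 r 𝒢 Q ≤ (h : EReal)) :
    ∃ C : Finset (S → Y), (∀ c ∈ C, c ∈ 𝒢) ∧ (∀ g ∈ 𝒢, ∃ c ∈ C, discreteL2 Q (g - c) ≤ r) ∧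
      (C.card : ℝ) ≤ Real.exp h := by
  have hN' : ((coveringNumberL2 r 𝒢 Q : ℕ∞) : ℝ≥0∞) ≤ ENNReal.ofReal (Real.exp h) := by
    rw [← EReal.exp_coe, ← ENNReal.exp_log ((coveringNumberL2 r 𝒢 Q : ℕ∞) : ℝ≥0∞)]
    exact EReal.exp_monotone hN
  have hfin : coveringNumberL2 r 𝒢 Q ≠ ⊤ := by
    intro htop
    rw [htop] at hN'
    simp at hN'
  have hlt : coveringNumberL2 r 𝒢 Q < coveringNumberL2 r 𝒢 Q + 1 :=
    (ENat.lt_add_one_iff hfin).mpr le_rfl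
  conv_lhs at hlt => rw [coveringNumberL2]
  simp only [iInf_lt_iff] at hlt
  obtain ⟨C, hC𝒢, hcov, hcard⟩ := hlt
  rw [ENat.lt_add_one_iff hfin] at hcard
  have hCfin : C.Finite := by
    rw [← Set.encard_ne_top_iff]
    exact ne_top_of_le_ne_top hfin hcard
  refine ⟨hCfin.toFinset, fun c hc => hC𝒢 (by simpa using hc), fun g hg => ?_, ?_⟩
  · obtain ⟨c, hc, hgc⟩ := hcov g hg
    exact ⟨c, by simpa using hc, hgc⟩
  · rw [hCfin.encard_eq_coe_toFinset_card] at hcard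
    have h1 : ((hCfin.toFinset.card : ℕ) : ℝ≥0∞) ≤ ENNReal.ofReal (Real.exp h) := by
      refine le_trans ?_ hN'
      exact_mod_cast ENat.toENNReal_le.mpr hcard
    rw [← ENNReal.ofReal_natCast] at h1
    exact (ENNReal.ofReal_le_ofReal_iff (Real.exp_pos h).le).mp h1

/-- On `[2⁻⁽ᵏ⁺¹⁾, 2⁻ᵏ]` the decreasing `√H` is at least its value at the right end, so each term is
at most twice the integral over that interval. -/
theorem summable_dyadic_sqrt {H : ℝ → ℝ} (hH : AntitoneOn H (Ioi 0))
    (hint : IntegrableOn (fun u => Real.sqrt (H u)) (Ioo 0 1) volume) :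
    Summable fun k : ℕ => (1 / 2 : ℝ) ^ k * (1 + Real.sqrt (H ((1 / 2) ^ k))) := by
  have hint' : IntegrableOn (fun u => Real.sqrt (H u)) (Ioc 0 1) volume :=
    (integrableOn_Ioc_iff_integrableOn_Ioo).mpr hint
  have hgeo : Summable fun k : ℕ => (1 / 2 : ℝ) ^ k := summable_geometric_two
  have hII : ∀ a b : ℝ, 0 ≤ a → a ≤ b → b ≤ 1 →
      IntervalIntegrable (fun u => Real.sqrt (H u)) volume a b := fun a b ha hab hb =>
    (intervalIntegrable_iff_integrableOn_Ioc_of_le hab).mpr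
      (hint'.mono_set (Ioc_subset_Ioc ha hb))
  have hpow : ∀ k : ℕ, (1 / 2 : ℝ) ^ k ≤ 1 := fun k => pow_le_one₀ (by norm_num) (by norm_num)
  have hanti : ∀ k : ℕ, (1 / 2 : ℝ) ^ (k + 1) ≤ (1 / 2) ^ k := fun k =>
    pow_le_pow_of_le_one (by norm_num) (by norm_num) (Nat.le_succ k)
  have hstep : ∀ k : ℕ, (1 / 2 : ℝ) ^ k * Real.sqrt (H ((1 / 2) ^ k))
      ≤ 2 * ∫ u in (1 / 2 : ℝ) ^ (k + 1)..(1 / 2) ^ k, Real.sqrt (H u) := by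
    intro k
    have h1 : ∫ u in (1 / 2 : ℝ) ^ (k + 1)..(1 / 2) ^ k, Real.sqrt (H ((1 / 2) ^ k))
        ≤ ∫ u in (1 / 2 : ℝ) ^ (k + 1)..(1 / 2) ^ k, Real.sqrt (H u) := by
      refine intervalIntegral.integral_mono_on (hanti k) (by simp)
        (hII _ _ (by positivity) (hanti k) (hpow k)) fun u hu => Real.sqrt_le_sqrt ?_
      have hu0 : 0 < u := lt_of_lt_of_le (by positivity) hu.1
      exact hH hu0 (mem_Ioi.mpr (by positivity)) hu.2
    rw [intervalIntegral.integral_const, smul_eq_mul, pow_succ] at h1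
    rw [pow_succ]
    linarith
  have hs2 : Summable fun k : ℕ => (1 / 2 : ℝ) ^ k * Real.sqrt (H ((1 / 2) ^ k)) := by
    refine summable_of_sum_range_le (c := 2 * ∫ u in (0 : ℝ)..1, Real.sqrt (H u))
      (fun k => by positivity) fun m => ?_
    calc _ ≤ ∑ k ∈ Finset.range m,
          2 * ∫ u in (1 / 2 : ℝ) ^ (k + 1)..(1 / 2) ^ k, Real.sqrt (H u) :=
          Finset.sum_le_sum fun k _ => hstep k
      _ = 2 * ∫ u in (1 / 2 : ℝ) ^ m..1, Real.sqrt (H u) := by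
          rw [← Finset.mul_sum]
          congr 1
          induction m with
          | zero => simp
          | succ m ih =>
            rw [Finset.sum_range_succ, ih, add_comm, intervalIntegral.integral_add_adjacent_intervals
              (hII _ _ (by positivity) (hanti m) (hpow m))
              (hII _ _ (by positivity) (hpow m) le_rfl)]
      _ ≤ _ := by
          refine mul_le_mul_of_nonneg_left ?_ zero_le_two
          rw [← intervalIntegral.integral_add_adjacent_intervals
            (hII 0 _ le_rfl (by positivity) (hpow m)) (hII _ 1 (by positivity) (hpow m) le_rfl)]
          exact le_add_of_nonneg_left
            (intervalIntegral.integral_nonneg (by positivity) fun u _ => Real.sqrt_nonneg _)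
  simpa [mul_add] using hgeo.add hs2

end Covering
-- Chaining bounds on a fixed sample.
section SampleBounds

/-- The vector `(g(x₁), …, g(xₙ))` with its Euclidean norm. -/
def sampleVec {S Z : Type*} {n : ℕ} (x : Fin n → S) (g : S → Z) : PiLp 2 fun _ : Fin n => Z :=
  WithLp.toLp 2 fun i => g (x i)

variable {S Y Z : Type*} [NormedAddCommGroup Y] [NormedAddCommGroup Z]

theorem norm_sampleVec_eq {n : ℕ} (x : Fin n → S) (g : S → Z) :
    ‖sampleVec x g‖ = Real.sqrt (∑ i, ‖g (x i)‖ ^ 2) := by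
  rw [PiLp.norm_eq_of_L2]; rfl

theorem norm_sampleVec_sq {n : ℕ} (x : Fin n → S) (g : S → Z) :
    ‖sampleVec x g‖ ^ 2 = ∑ i, ‖g (x i)‖ ^ 2 := by
  rw [PiLp.norm_sq_eq_of_L2]; rfl

theorem sampleVec_sub {n : ℕ} (x : Fin n → S) (g c : S → Z) :
    sampleVec x g - sampleVec x c = sampleVec x (g - c) := rfl

theorem norm_sampleVec_le {n : ℕ} (x : Fin n → S) {f : S → Z} {g : S → Y} {K : ℝ} (hK : 0 ≤ K)
    (h : ∀ i, ‖f (x i)‖ ≤ K * ‖g (x i)‖) : ‖sampleVec x f‖ ≤ K * ‖sampleVec x g‖ := by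
  refine le_of_sq_le_sq ?_ (by positivity)
  rw [mul_pow, norm_sampleVec_sq, norm_sampleVec_sq, Finset.mul_sum]
  refine Finset.sum_le_sum fun i _ => ?_
  rw [← mul_pow]
  exact pow_le_pow_left₀ (norm_nonneg _) (h i) 2

/-- The class `𝒢` has, for every sample and every `k`, a cover at the scale `2⁻ᵏ` times the
envelope with at most `exp (b k)` centres. -/
def HasDyadicCovers (𝒢 : Set (S → Y)) (b : ℕ → ℝ) : Prop :=
  ∀ (n : ℕ) [NeZero n] (x : Fin n → S) (k : ℕ), ∃ C : Finset (S → Y), (∀ c ∈ C, c ∈ 𝒢) ∧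
    (∀ g ∈ 𝒢, ∃ c ∈ C, ‖sampleVec x (g - c)‖ ≤ (1 / 2) ^ k * ‖sampleVec x (envelope 𝒢)‖) ∧
    (C.card : ℝ) ≤ Real.exp (b k)

/-- The empirical seminorm is `n ^ (-1/2)` times the Euclidean norm of the sample vector, and this
factor cancels between radius and envelope. -/
theorem UniformEntropyCondition.exists_hasDyadicCovers [Nonempty S] {𝒢 : Set (S → Y)}
    (hent : UniformEntropyCondition 𝒢) (hne : 𝒢.Nonempty) :
    ∃ b : ℕ → ℝ, (∀ k, 0 ≤ b k) ∧ Monotone b ∧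
      (Summable fun k : ℕ => (1 / 2 : ℝ) ^ k * (1 + Real.sqrt (b k))) ∧ HasDyadicCovers 𝒢 b := by
  obtain ⟨H, hH, hint, hN⟩ := hent
  have hcov : HasDyadicCovers 𝒢 fun k => H ((1 / 2) ^ k) := by
    intro n _ x k
    obtain ⟨C, hC, hcov, hcard⟩ := exists_finset_of_entropyL2_le
      (hN ((1 / 2) ^ k) (by positivity) (empiricalPMF x) (empiricalPMF_support_finite x))
    refine ⟨C, hC, fun g hg => ?_, hcard⟩
    obtain ⟨c, hc, hgc⟩ := hcov g hg
    refine ⟨c, hc, ?_⟩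
    rw [discreteL2_empiricalPMF, discreteL2_empiricalPMF, Real.sqrt_mul (by positivity),
      Real.sqrt_mul (by positivity), ← norm_sampleVec_eq, ← norm_sampleVec_eq,
      mul_left_comm] at hgc
    have hn : (0 : ℝ) < n := Nat.cast_pos.mpr (NeZero.pos n)
    exact le_of_mul_le_mul_left hgc (Real.sqrt_pos.mpr (by positivity))
  refine ⟨fun k => H ((1 / 2) ^ k), fun k => ?_, fun k l hkl => ?_, summable_dyadic_sqrt hH hint,
    hcov⟩
  -- A cover of a nonempty class has a centre, so `1 ≤ exp (b k)`.
  · obtain ⟨C, -, hc, hcard⟩ := hcov 1 (fun _ => Classical.arbitrary S) k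
    obtain ⟨g, hg⟩ := hne
    obtain ⟨c, hcC, -⟩ := hc g hg
    have : (1 : ℝ) ≤ C.card := by exact_mod_cast Finset.card_pos.mpr ⟨c, hcC⟩
    exact Real.one_le_exp_iff.mp (this.trans hcard)
  · exact hH (mem_Ioi.mpr (by positivity)) (mem_Ioi.mpr (by positivity))
      (pow_le_pow_of_le_one (by norm_num) (by norm_num) hkl)

theorem norm_le_envelope {𝒢 : Set (S → Y)}
    (hbdd : ∀ x, BddAbove (Set.range fun g : 𝒢 => ‖(g : S → Y) x‖)) {g : S → Y} (hg : g ∈ 𝒢)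
    (s : S) : ‖g s‖ ≤ envelope 𝒢 s :=
  le_ciSup (hbdd s) (⟨g, hg⟩ : 𝒢)

theorem envelope_nonneg (𝒢 : Set (S → Y)) (s : S) : 0 ≤ envelope 𝒢 s :=
  Real.iSup_nonneg fun _ => norm_nonneg _

variable {𝒢 F : Set (S → Y)} {b : ℕ → ℝ} {n : ℕ} [NeZero n]

theorem sum_iSup_signedSum_sub_le [InnerProductSpace ℝ Y] (hb : ∀ k, 0 ≤ b k) (hmono : Monotone b)
    (hsum : Summable fun k : ℕ => (1 / 2 : ℝ) ^ k * (1 + Real.sqrt (b k)))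
    (hcov : HasDyadicCovers 𝒢 b) (hF : F ⊆ 𝒢) (g₀ : S → Y) (x : Fin n → S) {R : ℝ} (hR0 : 0 ≤ R)
    (hR : ∀ g ∈ F, ‖sampleVec x (g - g₀)‖ ≤ R) (k₀ : ℕ) :
    ∑ τ : Fin n → Bool, ⨆ f ∈ (fun g : S → Y => g - g₀) '' F, ‖signedSum τ fun i => f (x i)‖ₑ
      ≤ 2 ^ n * ENNReal.ofReal (2 * (1 + Real.sqrt (b k₀)) * R
        + 6 * ‖sampleVec x (envelope 𝒢)‖
          * ∑' k, (1 / 2 : ℝ) ^ (k + k₀) * (1 + Real.sqrt (b (k + k₀)))) := by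
  classical
  choose C hC𝒢 hC hcard using fun k => hcov n x k
  have h := sum_iSup_signedSum_le ((fun g : S → Y => sampleVec x (g - g₀)) '' F)
    (fun k => (C k).image fun g => sampleVec x (g - g₀)) b hb hmono
    (norm_nonneg (sampleVec x (envelope 𝒢))) hR0 ?_ ?_ ?_ hsum k₀
  · refine le_trans (le_of_eq ?_) h
    refine Finset.sum_congr rfl fun τ _ => ?_
    rw [iSup_image, iSup_image]
    rfl
  · rintro k _ ⟨g, hg, rfl⟩
    obtain ⟨c, hc, hgc⟩ := hC k g (hF hg)
    refine ⟨_, Finset.mem_image_of_mem _ hc, ?_⟩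
    rwa [sampleVec_sub, sub_sub_sub_cancel_right]
  · exact fun k => le_trans (by exact_mod_cast Finset.card_image_le) (hcard k)
  · rintro _ ⟨g, hg, rfl⟩
    exact hR g hg

/-- Differences `g - g₀` have norm at most `2M` on the sample, so squaring is `4M`-Lipschitz there
and covers of `𝒢` become covers of the squares. Chaining starts at level `0`. -/
theorem sum_iSup_signedSum_sq_le (hb : ∀ k, 0 ≤ b k) (hmono : Monotone b)
    (hsum : Summable fun k : ℕ => (1 / 2 : ℝ) ^ k * (1 + Real.sqrt (b k)))
    (hcov : HasDyadicCovers 𝒢 b)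
    (hbdd : ∀ x, BddAbove (Set.range fun g : 𝒢 => ‖(g : S → Y) x‖)) (hF : F ⊆ 𝒢) {g₀ : S → Y}
    (hg₀ : g₀ ∈ 𝒢) (x : Fin n → S) {M : ℝ} (hM0 : 0 ≤ M) (hM : ∀ i, envelope 𝒢 (x i) ≤ M) :
    ∑ τ : Fin n → Bool, ⨆ f ∈ (fun (g : S → Y) (x : S) => ‖g x - g₀ x‖ ^ 2) '' F,
        ‖signedSum τ fun i => f (x i)‖ₑ
      ≤ 2 ^ n * ENNReal.ofReal ((8 * (1 + Real.sqrt (b 0))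
        + 24 * ∑' k, (1 / 2 : ℝ) ^ k * (1 + Real.sqrt (b k)))
          * (M * ‖sampleVec x (envelope 𝒢)‖)) := by
  classical
  choose C hC𝒢 hC hcard using fun k => hcov n x k
  set G := envelope 𝒢 with hG
  have hdiff : ∀ g ∈ 𝒢, ∀ i, ‖g (x i) - g₀ (x i)‖ ≤ 2 * G (x i) := fun g hg i =>
    (norm_sub_le _ _).trans (by
      have h1 := norm_le_envelope hbdd hg (x i)
      have h2 := norm_le_envelope hbdd hg₀ (x i)
      linarith)
  set sq : (S → Y) → S → ℝ := fun g x => ‖g x - g₀ x‖ ^ 2 with hsq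
  have h := sum_iSup_signedSum_le ((fun g : S → Y => sampleVec x (sq g)) '' F)
    (fun k => (C k).image fun g => sampleVec x (sq g)) b hb hmono
    (r := 4 * M * ‖sampleVec x G‖) (R := 4 * M * ‖sampleVec x G‖)
    (by positivity) (by positivity) ?_ ?_ ?_ hsum 0
  · refine le_trans (le_of_eq ?_) (h.trans (le_of_eq ?_))
    · refine Finset.sum_congr rfl fun τ _ => ?_
      rw [iSup_image, iSup_image]
      rfl
    · simp only [add_zero]
      congr 2
      ring
  · rintro k _ ⟨g, hg, rfl⟩
    obtain ⟨c, hc, hgc⟩ := hC k g (hF hg)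
    refine ⟨_, Finset.mem_image_of_mem _ hc, ?_⟩
    rw [sampleVec_sub]
    refine (norm_sampleVec_le x (g := g - c) (K := 4 * M) (by positivity) fun i => ?_).trans ?_
    · simp only [hsq, Pi.sub_apply]
      rw [sq_sub_sq, Real.norm_eq_abs, abs_mul, abs_of_nonneg (by positivity)]
      refine mul_le_mul ?_ ?_ (abs_nonneg _) (by positivity)
      · have h1 := hdiff g (hF hg) i
        have h2 := hdiff c (hC𝒢 k c hc) i
        have h3 := hM i
        linarith
      · refine (abs_norm_sub_norm_le _ _).trans (le_of_eq ?_)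
        rw [sub_sub_sub_cancel_right]
    · have := mul_le_mul_of_nonneg_left hgc (show 0 ≤ 4 * M by positivity)
      linarith
  · exact fun k => le_trans (by exact_mod_cast Finset.card_image_le) (hcard k)
  · rintro _ ⟨g, hg, rfl⟩
    refine norm_sampleVec_le x (by positivity) fun i => ?_
    have h1 := hdiff g (hF hg) i
    have h2 := hM i
    have h3 : 0 ≤ G (x i) := envelope_nonneg 𝒢 _
    simp only [hsq, Real.norm_eq_abs, abs_pow, abs_norm]
    rw [abs_of_nonneg h3]
    calc ‖g (x i) - g₀ (x i)‖ ^ 2 ≤ (2 * G (x i)) ^ 2 := by gcongr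
      _ = 4 * G (x i) * G (x i) := by ring
      _ ≤ 4 * M * G (x i) := by gcongr

end SampleBounds
-- Mean bounds: law of large numbers for squares and the local maximal inequality.
section Empirical

/-- Makes square roots of sample sums affine in those sums, so that they integrate term by term. -/
theorem mul_le_sq_div_add_mul_sq (a c : ℝ) {e : ℝ} (he : 0 < e) :
    a * c ≤ a ^ 2 / (2 * e) + e * c ^ 2 / 2 := by
  have h : a ^ 2 / (2 * e) + e * c ^ 2 / 2 - a * c = (a - e * c) ^ 2 / (2 * e) := by
    field_simp; ring
  have : 0 ≤ (a - e * c) ^ 2 / (2 * e) := by positivity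
  linarith

section Truncation

variable {S : Type*} [MeasurableSpace S] (P : Measure S)

/-- Dominated by `G²`. With `max G(xᵢ)² ≤ K² + ∑ (G(xᵢ)² - K²)⁺`, it makes the mean of the maximum
`o(n)`. -/
theorem tendsto_integral_max_sq_sub_sq {G : S → ℝ} (hG : MemLp G 2 P) :
    Tendsto (fun K : ℕ => ∫ s, max (G s ^ 2 - (K : ℝ) ^ 2) 0 ∂P) atTop (𝓝 0) := by
  have h := tendsto_integral_of_dominated_convergence (μ := P)
    (F := fun (K : ℕ) s => max (G s ^ 2 - (K : ℝ) ^ 2) 0) (f := fun _ => 0) (fun s => G s ^ 2)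
    (fun K => ?_) hG.integrable_sq (fun K => ?_) ?_
  · simpa using h
  · exact (((hG.aestronglyMeasurable.aemeasurable.pow_const 2).sub_const _).max
      aemeasurable_const).aestronglyMeasurable
  · refine ae_of_all _ fun s => ?_
    rw [Real.norm_eq_abs, abs_of_nonneg (le_max_right _ _)]
    have := sq_nonneg (K : ℝ)
    exact max_le (by linarith) (sq_nonneg _)
  · refine ae_of_all _ fun s => ?_
    refine tendsto_const_nhds.congr' ?_
    filter_upwards [eventually_ge_atTop ⌈|G s|⌉₊] with K hK
    have h1 : |G s| ≤ K := Nat.ceil_le.mp hK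
    have h2 : G s ^ 2 ≤ (K : ℝ) ^ 2 := by
      rw [← sq_abs]; gcongr
    exact (max_eq_right (by linarith)).symm

variable {P} {Y : Type*} [NormedAddCommGroup Y] {𝒢 : Set (S → Y)}

theorem memLp_two_of_mem (hint : ∀ g ∈ 𝒢, Integrable g P)
    (hbdd : ∀ x, BddAbove (Set.range fun g : 𝒢 => ‖(g : S → Y) x‖)) (hG : MemLp (envelope 𝒢) 2 P)
    {g : S → Y} (hg : g ∈ 𝒢) : MemLp g 2 P :=
  hG.mono' (hint g hg).aestronglyMeasurable (ae_of_all _ fun s => norm_le_envelope hbdd hg s)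

theorem integral_norm_sq_le_of_eLpNorm_le {f : S → Y} (hf : MemLp f 2 P) {δ : ℝ} (hδ : 0 ≤ δ)
    (h : eLpNorm f 2 P ≤ ENNReal.ofReal δ) : ∫ s, ‖f s‖ ^ 2 ∂P ≤ δ ^ 2 := by
  rw [hf.eLpNorm_eq_integral_rpow_norm two_ne_zero ENNReal.ofNat_ne_top,
    ENNReal.ofReal_le_ofReal_iff hδ] at h
  have h0 : 0 ≤ ∫ s, ‖f s‖ ^ 2 ∂P := integral_nonneg fun s => by positivity
  have h1 : Real.sqrt (∫ s, ‖f s‖ ^ 2 ∂P) ≤ δ := by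
    rw [Real.sqrt_eq_rpow]
    simpa using h
  exact (Real.sqrt_le_left hδ).mp h1

end Truncation

variable {S : Type*} [MeasurableSpace S] (P : Measure S) [IsProbabilityMeasure P]

theorem integrable_sum_comp_eval {n : ℕ} {f : S → ℝ} (hf : Integrable f P) :
    Integrable (fun x : Fin n → S => ∑ i, f (x i)) (Measure.pi fun _ => P) :=
  integrable_finsetSum _ fun _ _ => integrable_comp_eval hf

theorem integral_sum_comp_eval {n : ℕ} {f : S → ℝ} (hf : Integrable f P) :
    ∫ x : Fin n → S, ∑ i, f (x i) ∂(Measure.pi fun _ => P) = n * ∫ s, f s ∂P := by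
  rw [integral_finsetSum _ fun i _ => integrable_comp_eval hf]
  simp [integral_comp_eval (μ := fun _ : Fin n => P) hf.aestronglyMeasurable]

variable {P} {Y : Type*} [NormedAddCommGroup Y] [InnerProductSpace ℝ Y]
  {𝒢 : Set (S → Y)} {b : ℕ → ℝ} {g₀ : S → Y}

/-- The uniform law of large numbers for the squared norms, with a measurable majorant. -/
theorem exists_sq_majorant (hint : ∀ g ∈ 𝒢, Integrable g P) (hmeas : MeasurableClass P 𝒢)
    (hbdd : ∀ x, BddAbove (Set.range fun g : 𝒢 => ‖(g : S → Y) x‖)) (hG : MemLp (envelope 𝒢) 2 P)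
    (hb : ∀ k, 0 ≤ b k) (hmono : Monotone b)
    (hsum : Summable fun k : ℕ => (1 / 2 : ℝ) ^ k * (1 + Real.sqrt (b k)))
    (hcov : HasDyadicCovers 𝒢 b) (hg₀ : g₀ ∈ 𝒢) {η : ℝ} (hη : 0 < η) :
    ∃ n₀ : ℕ, ∀ n ≥ n₀, 0 < n → ∀ δ : ℝ, 0 < δ → ∃ h : (Fin n → S) → ℝ≥0∞, Measurable h ∧
      (∀ x, ∀ g ∈ localBall P 𝒢 g₀ δ,
        ‖∑ i, ‖g (x i) - g₀ (x i)‖ ^ 2 - (n : ℝ) • ∫ s, ‖g s - g₀ s‖ ^ 2 ∂P‖ₑ ≤ h x) ∧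
      ∫⁻ x, h x ∂(Measure.pi fun _ => P) ≤ ENNReal.ofReal (n * η) := by
  set G := envelope 𝒢 with hGdef
  set γ := ∫ s, G s ^ 2 ∂P with hγ
  have hγ0 : 0 ≤ γ := integral_nonneg fun s => sq_nonneg _
  set c := 8 * (1 + Real.sqrt (b 0))
    + 24 * ∑' k, (1 / 2 : ℝ) ^ k * (1 + Real.sqrt (b k)) with hc
  have hc0 : 0 < c := by
    have : 0 ≤ ∑' k, (1 / 2 : ℝ) ^ k * (1 + Real.sqrt (b k)) := tsum_nonneg fun k => by positivity
    have := Real.sqrt_nonneg (b 0)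
    linarith
  -- The mean of `φ` has three terms, each brought below `n η / 8`: the envelope term by `e`, the
  -- truncation term by `K`, the constant term by `n₀`.
  set e := η / (4 * c * (γ + 1)) with he
  have he0 : 0 < e := by positivity
  have hcγ : c * (e * γ / 2) ≤ η / 8 := by
    have : c * (e * γ / 2) = η / 8 * (γ / (γ + 1)) := by rw [he]; field_simp; ring
    rw [this]
    exact mul_le_of_le_one_right (by positivity) ((div_le_one (by positivity)).mpr (by linarith))
  obtain ⟨K, hK⟩ := ((tendsto_integral_max_sq_sub_sq P hG).eventually
    (ge_mem_nhds (show (0 : ℝ) < η * e / (4 * c) by positivity))).exists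
  set ψ : S → ℝ := fun s => max (G s ^ 2 - (K : ℝ) ^ 2) 0 with hψ
  have hψ0 : ∀ s, 0 ≤ ψ s := fun s => le_max_right _ _
  have hGsq : Integrable (fun s => G s ^ 2) P := hG.integrable_sq
  have hψint : Integrable ψ P := by
    refine hGsq.mono' ((((hG.aestronglyMeasurable.aemeasurable.pow_const 2).sub_const _).max
      aemeasurable_const).aestronglyMeasurable) (ae_of_all _ fun s => ?_)
    rw [Real.norm_eq_abs, abs_of_nonneg (hψ0 s)]
    have := sq_nonneg (K : ℝ)
    exact max_le (by linarith) (sq_nonneg _)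
  obtain ⟨n₀, hn₀⟩ := exists_nat_ge (c * ((K : ℝ) ^ 2 / (2 * e)) / (η / 8))
  refine ⟨n₀, fun n hn hnpos δ hδ => ?_⟩
  have : NeZero n := ⟨hnpos.ne'⟩
  set φ : (Fin n → S) → ℝ := fun x =>
    c * (((K : ℝ) ^ 2 + ∑ i, ψ (x i)) / (2 * e) + e * (∑ i, G (x i) ^ 2) / 2) with hφ
  have hφ0 : ∀ x, 0 ≤ φ x := fun x => by
    have h1 : 0 ≤ ∑ i, ψ (x i) := Finset.sum_nonneg fun i _ => hψ0 _
    have h2 : 0 ≤ ∑ i, G (x i) ^ 2 := Finset.sum_nonneg fun i _ => sq_nonneg _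
    simp only [hφ]
    positivity
  have hi1 := integrable_sum_comp_eval P (n := n) hψint
  have hi2 := integrable_sum_comp_eval P (n := n) hGsq
  have hi3 : Integrable (fun x : Fin n → S => ((K : ℝ) ^ 2 + ∑ i, ψ (x i)) / (2 * e))
      (Measure.pi fun _ => P) := ((integrable_const ((K : ℝ) ^ 2)).add hi1).div_const (2 * e)
  have hi4 := (hi2.const_mul e).div_const 2
  have hφint : Integrable φ (Measure.pi fun _ => P) := (hi3.add hi4).const_mul c
  have hφI : ∫ x, φ x ∂(Measure.pi fun _ => P)
      = c * (((K : ℝ) ^ 2 + n * ∫ s, ψ s ∂P) / (2 * e) + e * (n * γ) / 2) := by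
    have e1 : ∫ x : Fin n → S, φ x ∂(Measure.pi fun _ => P)
        = c * (∫ x : Fin n → S, ((K : ℝ) ^ 2 + ∑ i, ψ (x i)) / (2 * e) ∂(Measure.pi fun _ => P)
          + ∫ x : Fin n → S, e * (∑ i, G (x i) ^ 2) / 2 ∂(Measure.pi fun _ => P)) := by
      rw [← integral_add hi3 hi4, ← integral_const_mul]
    rw [e1, integral_div, integral_div, integral_const_mul,
      integral_add (integrable_const _) hi1, integral_sum_comp_eval P hψint,
      integral_sum_comp_eval P hGsq]
    simp [← hγ]
  have hFint : ∀ f ∈ (fun (g : S → Y) (x : S) => ‖g x - g₀ x‖ ^ 2) '' localBall P 𝒢 g₀ δ,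
      Integrable f P := by
    rintro _ ⟨g, hg, rfl⟩
    exact ((memLp_two_of_mem hint hbdd hG hg.1).sub
      (memLp_two_of_mem hint hbdd hG hg₀)).norm.integrable_sq
  have hpt : ∀ x, ∑ τ : Fin n → Bool,
      ⨆ f ∈ (fun (g : S → Y) (x : S) => ‖g x - g₀ x‖ ^ 2) '' localBall P 𝒢 g₀ δ,
        ‖signedSum τ fun i => f (x i)‖ₑ ≤ 2 ^ n * ENNReal.ofReal (φ x) := by
    intro x
    set M := Real.sqrt ((K : ℝ) ^ 2 + ∑ i, ψ (x i)) with hM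
    have hψs : 0 ≤ ∑ i, ψ (x i) := Finset.sum_nonneg fun i _ => hψ0 _
    have hM2 : M ^ 2 = (K : ℝ) ^ 2 + ∑ i, ψ (x i) := Real.sq_sqrt (by positivity)
    refine (sum_iSup_signedSum_sq_le hb hmono hsum hcov hbdd (fun g hg => hg.1) hg₀ x
      (M := M) (Real.sqrt_nonneg _) fun i => ?_).trans ?_
    · refine Real.le_sqrt_of_sq_le ?_
      have h1 : G (x i) ^ 2 - (K : ℝ) ^ 2 ≤ ψ (x i) := le_max_left _ _
      have h2 := Finset.single_le_sum (f := fun i => ψ (x i)) (fun i _ => hψ0 _)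
        (Finset.mem_univ i)
      linarith
    · gcongr
      have := mul_le_sq_div_add_mul_sq M ‖sampleVec x G‖ he0
      rw [hM2, norm_sampleVec_sq] at this
      simp only [Real.norm_eq_abs, sq_abs] at this
      exact mul_le_mul_of_nonneg_left this hc0.le
  obtain ⟨h, hh, hle, hI⟩ := exists_centered_majorant P ((hmeas g₀ hg₀ δ hδ).2) hFint n
    (fun x => ENNReal.ofReal (φ x)) hpt
  refine ⟨h, hh, fun x g hg => hle x _ (mem_image_of_mem _ hg), hI.trans ?_⟩
  rw [← ofReal_integral_eq_lintegral_ofReal hφint (ae_of_all _ hφ0), hφI,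
    ← ENNReal.ofReal_ofNat 2, ← ENNReal.ofReal_mul zero_le_two]
  refine ENNReal.ofReal_le_ofReal ?_
  have hn' : (n₀ : ℝ) ≤ n := by exact_mod_cast hn
  have t1 : c * ((K : ℝ) ^ 2 / (2 * e)) ≤ n * (η / 8) :=
    (div_le_iff₀ (by positivity)).mp (hn₀.trans hn')
  have t2 : c * ((∫ s, ψ s ∂P) / (2 * e)) ≤ η / 8 := by
    calc c * ((∫ s, ψ s ∂P) / (2 * e)) ≤ c * ((η * e / (4 * c)) / (2 * e)) := by gcongr
      _ = η / 8 := by field_simp; norm_num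
  have hn0 : (0 : ℝ) ≤ n := Nat.cast_nonneg n
  have t2' := mul_le_mul_of_nonneg_left t2 hn0
  have t3' := mul_le_mul_of_nonneg_left hcγ hn0
  have e2 : c * (((K : ℝ) ^ 2 + n * ∫ s, ψ s ∂P) / (2 * e) + e * (n * γ) / 2)
      = c * ((K : ℝ) ^ 2 / (2 * e)) + n * (c * ((∫ s, ψ s ∂P) / (2 * e)))
        + n * (c * (e * γ / 2)) := by ring
  rw [e2]
  nlinarith

/-- Maximal inequality for the empirical process over a small ball, with a measurable majorant. -/
theorem exists_local_majorant [CompleteSpace Y] (hint : ∀ g ∈ 𝒢, Integrable g P)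
    (hmeas : MeasurableClass P 𝒢)
    (hbdd : ∀ x, BddAbove (Set.range fun g : 𝒢 => ‖(g : S → Y) x‖)) (hG : MemLp (envelope 𝒢) 2 P)
    (hb : ∀ k, 0 ≤ b k) (hmono : Monotone b)
    (hsum : Summable fun k : ℕ => (1 / 2 : ℝ) ^ k * (1 + Real.sqrt (b k)))
    (hcov : HasDyadicCovers 𝒢 b) (hg₀ : g₀ ∈ 𝒢) {η : ℝ} (hη : 0 < η) :
    ∃ δ : ℝ, 0 < δ ∧ ∃ n₀ : ℕ, ∀ n ≥ n₀, 0 < n → ∃ h : (Fin n → S) → ℝ≥0∞, Measurable h ∧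
      (∀ x, ∀ g ∈ localBall P 𝒢 g₀ δ,
        ‖∑ i, (g - g₀) (x i) - (n : ℝ) • ∫ s, (g - g₀) s ∂P‖ₑ ≤ h x) ∧
      ∫⁻ x, h x ∂(Measure.pi fun _ => P) ≤ ENNReal.ofReal (η * Real.sqrt n) := by
  set G := envelope 𝒢 with hGdef
  set γ := ∫ s, G s ^ 2 ∂P with hγ
  have hγ0 : 0 ≤ γ := integral_nonneg fun s => sq_nonneg _
  -- Order of choice: `k₀` makes the chaining tail small and fixes the factor `A` of the radius; `e`
  -- and `δ` then compensate for `A`.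
  obtain ⟨k₀, hk₀⟩ := ((tendsto_sum_nat_add
    fun k : ℕ => (1 / 2 : ℝ) ^ k * (1 + Real.sqrt (b k))).eventually
    (ge_mem_nhds (show (0 : ℝ) < η / (24 * (γ + 1)) by positivity))).exists
  set s := ∑' k, (1 / 2 : ℝ) ^ (k + k₀) * (1 + Real.sqrt (b (k + k₀))) with hs
  have hs0 : 0 ≤ s := tsum_nonneg fun k => by positivity
  have hsγ : 3 * s * (γ + 1) ≤ η / 8 := by
    calc 3 * s * (γ + 1) ≤ 3 * (η / (24 * (γ + 1))) * (γ + 1) := by gcongr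
      _ = η / 8 := by field_simp; norm_num
  set A := 2 * (1 + Real.sqrt (b k₀)) with hA
  have hA0 : 0 < A := by positivity
  set e := η / (4 * A) with he
  have he0 : 0 < e := by positivity
  set η' := e * η / (8 * A) with hη'
  have hη'0 : 0 < η' := by positivity
  set δ := Real.sqrt η' with hδ
  have hδ0 : 0 < δ := Real.sqrt_pos.mpr hη'0
  have hδ2 : δ ^ 2 = η' := Real.sq_sqrt hη'0.le
  obtain ⟨n₀, hn₀⟩ := exists_sq_majorant hint hmeas hbdd hG hb hmono hsum hcov hg₀ hη'0
  refine ⟨δ, hδ0, n₀, fun n hn hnpos => ?_⟩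
  have : NeZero n := ⟨hnpos.ne'⟩
  obtain ⟨h₂, hh₂, hle₂, hI₂⟩ := hn₀ n hn hnpos δ hδ0
  have hnR : (0 : ℝ) < n := by exact_mod_cast hnpos
  set q := Real.sqrt n with hq
  have hq0 : 0 < q := Real.sqrt_pos.mpr hnR
  have hq2 : q ^ 2 = n := Real.sq_sqrt hnR.le
  set a := A / (2 * (e * q)) with ha
  have ha0 : 0 < a := by positivity
  set φ : (Fin n → S) → ℝ := fun x =>
    (a * (n * δ ^ 2) + A * (e * q) / 2 + 3 * s * q) + 3 * s / q * ∑ i, G (x i) ^ 2 with hφ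
  have hφ0 : ∀ x, 0 ≤ φ x := fun x => by
    have h2 : 0 ≤ ∑ i, G (x i) ^ 2 := Finset.sum_nonneg fun i _ => sq_nonneg _
    simp only [hφ]
    positivity
  have hGsq : Integrable (fun s => G s ^ 2) P := hG.integrable_sq
  have hi2 := (integrable_sum_comp_eval P (n := n) hGsq).const_mul (3 * s / q)
  have hφint : Integrable φ (Measure.pi fun _ => P) := (integrable_const _).add hi2
  have hφI : ∫ x, φ x ∂(Measure.pi fun _ => P)
      = (a * (n * δ ^ 2) + A * (e * q) / 2 + 3 * s * q) + 3 * s / q * (n * γ) := by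
    rw [integral_add (integrable_const _) hi2, integral_const_mul, integral_sum_comp_eval P hGsq]
    simp [← hγ]
  have hbound : 2 * (a * (n * η') + ((a * (n * δ ^ 2) + A * (e * q) / 2 + 3 * s * q)
      + 3 * s / q * (n * γ))) ≤ η * q := by
    have t1 : a * (n * η') = η / 16 * q := by
      rw [ha, hη', ← hq2]; field_simp; norm_num
    have t2 : A * (e * q) / 2 = η / 8 * q := by rw [he]; field_simp; norm_num
    have t3 : 3 * s / q * (n * γ) = 3 * s * γ * q := by rw [← hq2]; field_simp
    rw [hδ2, t1, t2, t3]
    have := mul_le_mul_of_nonneg_right hsγ hq0.le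
    nlinarith
  have hFint : ∀ f ∈ (fun g : S → Y => g - g₀) '' localBall P 𝒢 g₀ δ, Integrable f P := by
    rintro _ ⟨g, hg, rfl⟩
    exact (hint g hg.1).sub (hint g₀ hg₀)
  have hpt : ∀ x, ∑ τ : Fin n → Bool, ⨆ f ∈ (fun g : S → Y => g - g₀) '' localBall P 𝒢 g₀ δ,
      ‖signedSum τ fun i => f (x i)‖ₑ
        ≤ 2 ^ n * (ENNReal.ofReal a * h₂ x + ENNReal.ofReal (φ x)) := by
    intro x
    by_cases htop : h₂ x = ⊤
    · have h1 : ENNReal.ofReal a * h₂ x = ⊤ := by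
        rw [htop]; exact ENNReal.mul_top (by simpa using ha0)
      simp [h1, ENNReal.mul_top]
    -- The empirical radius of the ball: at most `n δ²` for the population part plus `h₂` for the
    -- fluctuation of the squared norms.
    set R := Real.sqrt ((h₂ x).toReal + n * δ ^ 2) with hR
    have hR2 : R ^ 2 = (h₂ x).toReal + n * δ ^ 2 := Real.sq_sqrt (by positivity)
    refine (sum_iSup_signedSum_sub_le hb hmono hsum hcov (F := localBall P 𝒢 g₀ δ)
      (fun g hg => hg.1) g₀ x (R := R) (Real.sqrt_nonneg _) (fun g hg => ?_) k₀).trans ?_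
    · refine Real.le_sqrt_of_sq_le ?_
      rw [norm_sampleVec_sq]
      have h1 := hle₂ x g hg
      rw [← ofReal_norm, ENNReal.ofReal_le_iff_le_toReal htop, Real.norm_eq_abs] at h1
      have h2 := le_of_abs_le h1
      have h3 := integral_norm_sq_le_of_eLpNorm_le ((memLp_two_of_mem hint hbdd hG hg.1).sub
        (memLp_two_of_mem hint hbdd hG hg₀)) hδ0.le hg.2
      simp only [Pi.sub_apply, smul_eq_mul] at h2 h3 ⊢
      have h4 := mul_le_mul_of_nonneg_left h3 hnR.le
      linarith
    · gcongr
      rw [← ENNReal.ofReal_toReal htop, ← ENNReal.ofReal_mul ha0.le,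
        ← ENNReal.ofReal_add (by positivity) (hφ0 x)]
      refine ENNReal.ofReal_le_ofReal ?_
      -- The free parameters are of order `√n`, so all terms have mean of order `√n`.
      have h1 := mul_le_sq_div_add_mul_sq R 1 (show 0 < e * q by positivity)
      have h2 := mul_le_sq_div_add_mul_sq ‖sampleVec x G‖ 1 hq0
      rw [hR2] at h1
      rw [norm_sampleVec_sq] at h2
      simp only [Real.norm_eq_abs, sq_abs] at h2
      have h1' := mul_le_mul_of_nonneg_left h1 hA0.le
      have h2' := mul_le_mul_of_nonneg_left h2 (show 0 ≤ 6 * s by positivity)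
      have e1 : A * (((h₂ x).toReal + n * δ ^ 2) / (2 * (e * q)) + e * q * 1 ^ 2 / 2)
          = a * (h₂ x).toReal + a * (n * δ ^ 2) + A * (e * q) / 2 := by
        rw [ha]; ring
      have e2 : 6 * s * ((∑ i, G (x i) ^ 2) / (2 * q) + q * 1 ^ 2 / 2)
          = 3 * s * q + 3 * s / q * ∑ i, G (x i) ^ 2 := by
        field_simp; ring
      rw [e1] at h1'
      rw [e2] at h2'
      simp only [hφ]
      linarith
  obtain ⟨h, hh, hle, hI⟩ := exists_centered_majorant P ((hmeas g₀ hg₀ δ hδ0).1) hFint n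
    (fun x => ENNReal.ofReal a * h₂ x + ENNReal.ofReal (φ x)) hpt
  refine ⟨h, hh, fun x g hg => hle x _ (mem_image_of_mem _ hg), hI.trans ?_⟩
  rw [lintegral_add_left (hh₂.const_mul _), lintegral_const_mul _ hh₂,
    ← ofReal_integral_eq_lintegral_ofReal hφint (ae_of_all _ hφ0), hφI]
  refine le_trans ?_ (ENNReal.ofReal_le_ofReal hbound)
  rw [ENNReal.ofReal_mul zero_le_two, ENNReal.ofReal_add (p := a * (n * η')) (by positivity)
    (by positivity), ENNReal.ofReal_mul (q := n * η') ha0.le, ENNReal.ofReal_ofNat]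
  gcongr

end Empirical
end VectorEmpirical

/-! ### Asymptotic equicontinuity. -/

theorem VectorEmpirical.enorm_empiricalNu_sub {Ω S Y : Type*} [MeasurableSpace S]
    [NormedAddCommGroup Y] [NormedSpace ℝ Y] (P : Measure S) (X : ℕ → Ω → S) {n : ℕ} (hn : 0 < n)
    {g g₀ : S → Y} (hg : Integrable g P) (hg₀ : Integrable g₀ P) (ω : Ω) :
    ‖empiricalNu P X n g ω - empiricalNu P X n g₀ ω‖ * Real.sqrt n
      = ‖∑ i : Fin n, (g - g₀) (X i ω) - (n : ℝ) • ∫ s, (g - g₀) s ∂P‖ := by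
  have hnR : (0 : ℝ) < n := by exact_mod_cast hn
  have hI : ∫ s, (g - g₀) s ∂P = ∫ s, g s ∂P - ∫ s, g₀ s ∂P := integral_sub hg hg₀
  have hS : ∑ i : Fin n, (g - g₀) (X i ω)
      = ∑ i ∈ Finset.range n, g (X i ω) - ∑ i ∈ Finset.range n, g₀ (X i ω) := by
    rw [Fin.sum_univ_eq_sum_range fun i => (g - g₀) (X i ω)]
    simp [Finset.sum_sub_distrib]
  have key : ∑ i : Fin n, (g - g₀) (X i ω) - (n : ℝ) • ∫ s, (g - g₀) s ∂P
      = Real.sqrt n • (empiricalNu P X n g ω - empiricalNu P X n g₀ ω) := by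
    rw [hI, hS, empiricalNu, empiricalNu, ← smul_sub, smul_smul, Real.mul_self_sqrt hnR.le,
      sub_sub_sub_comm, ← smul_sub, smul_sub _ ((n : ℝ)⁻¹ • _), smul_inv_smul₀ hnR.ne']
  rw [key, norm_smul, Real.norm_of_nonneg (Real.sqrt_nonneg _), mul_comm]

theorem mainTheorem7 {Ω S Y : Type*}
    [MeasurableSpace Ω] (μ : Measure Ω) [IsProbabilityMeasure μ]
    [MeasurableSpace S] (P : Measure S) [IsProbabilityMeasure P]
    [NormedAddCommGroup Y] [InnerProductSpace ℝ Y] [CompleteSpace Y]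
    [TopologicalSpace.SeparableSpace Y]
    (X : ℕ → Ω → S) (hX : ∀ i, Measurable (X i)) (hlaw : ∀ i, μ.map (X i) = P)
    (hindep : iIndepFun X μ)
    (𝒢 : Set (S → Y)) (hint : ∀ g ∈ 𝒢, Integrable g P)
    (hmeas : VectorEmpirical.MeasurableClass P 𝒢)
    (hbdd : ∀ x, BddAbove (Set.range fun g : 𝒢 => ‖(g : S → Y) x‖))
    (hG : MemLp (VectorEmpirical.envelope 𝒢) 2 P)
    (hentropy : VectorEmpirical.UniformEntropyCondition 𝒢) :
    VectorEmpirical.AsymptoticallyEquicontinuous μ P X 𝒢 := by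
  intro g₀ hg₀ ghat hghat hconv
  have : Nonempty S := P.nonempty_of_neZero
  obtain ⟨b, hb, hmono, hsum, hcov⟩ := hentropy.exists_hasDyadicCovers ⟨g₀, hg₀⟩
  have hlawn : ∀ n : ℕ, μ.map (fun ω (i : Fin n) => X i ω) = Measure.pi fun _ => P := by
    intro n
    have h := iIndepFun.map_fun_eq_pi_map (f := fun i : Fin n => X i)
      (fun i => (hX i).aemeasurable) (hindep.precomp Fin.val_injective)
    simpa only [hlaw] using h
  rw [tendstoInMeasure_iff_norm] at hconv ⊢
  intro ε hε
  rw [ENNReal.tendsto_nhds_zero]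
  intro θ hθ
  obtain ⟨θ', hθ'0, hθ'⟩ : ∃ θ' : ℝ, 0 < θ' ∧ ENNReal.ofReal θ' + ENNReal.ofReal θ' ≤ θ := by
    obtain ⟨t, ht0, ht⟩ := ENNReal.lt_iff_exists_nnreal_btwn.mp (ENNReal.half_pos hθ.ne')
    refine ⟨t, by exact_mod_cast ht0, ?_⟩
    rw [ENNReal.ofReal_coe_nnreal]
    exact (add_le_add ht.le ht.le).trans (ENNReal.add_halves θ).le
  -- With `η = θ' ε`, Markov's inequality at level `ε √n` leaves exactly `θ'`.
  obtain ⟨δ, hδ, n₀, hn₀⟩ := VectorEmpirical.exists_local_majorant hint hmeas hbdd hG hb hmono hsum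
    hcov hg₀ (mul_pos hθ'0 hε)
  filter_upwards [ENNReal.tendsto_nhds_zero.mp (hconv δ hδ) (ENNReal.ofReal θ') (by simpa),
    eventually_ge_atTop n₀, eventually_gt_atTop 0] with n h1 hn hnpos
  obtain ⟨h, hh, hle, hI⟩ := hn₀ n hn hnpos
  have hnR : (0 : ℝ) < n := by exact_mod_cast hnpos
  have hq : 0 < Real.sqrt n := Real.sqrt_pos.mpr hnR
  have hXn : Measurable fun ω (i : Fin n) => X i ω := measurable_pi_lambda _ fun i => hX i
  have h2 : μ {ω | ENNReal.ofReal (ε * Real.sqrt n) ≤ h fun i => X i ω} ≤ ENNReal.ofReal θ' := by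
    refine (meas_ge_le_lintegral_div (hh.comp hXn).aemeasurable
      (by simpa using mul_pos hε hq) ENNReal.ofReal_ne_top).trans ?_
    refine ENNReal.div_le_of_le_mul ?_
    have e : ∫⁻ ω, (h ∘ fun ω (i : Fin n) => X i ω) ω ∂μ
        = ∫⁻ x, h x ∂(Measure.pi fun _ => P) := by
      rw [← hlawn n, lintegral_map hh hXn]; rfl
    rw [e, ← ENNReal.ofReal_mul hθ'0.le, ← mul_assoc]
    exact hI
  refine le_trans ?_ ((add_le_add h1 h2).trans hθ')
  -- Monotonicity and subadditivity hold for outer measure, so no measurability of `ghat` is needed.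
  refine (measure_mono fun ω hω => ?_).trans (measure_union_le _ _)
  simp only [mem_ofPred_eq, sub_zero, norm_norm, mem_union] at hω ⊢
  by_contra! hcon
  obtain ⟨hc1, hc2⟩ := hcon
  rw [Real.norm_of_nonneg ENNReal.toReal_nonneg] at hc1
  have hmem : ghat n ω ∈ VectorEmpirical.localBall P 𝒢 g₀ δ := by
    refine ⟨hghat n ω, ?_⟩
    -- `toReal` sends `∞` to `0`, so finiteness is needed to conclude that the norm is small.
    have hfin : eLpNorm (ghat n ω - g₀) 2 P ≠ ⊤ :=
      ((VectorEmpirical.memLp_two_of_mem hint hbdd hG (hghat n ω)).sub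
        (VectorEmpirical.memLp_two_of_mem hint hbdd hG hg₀)).2.ne
    rw [← ENNReal.ofReal_toReal hfin]
    exact ENNReal.ofReal_le_ofReal hc1.le
  refine absurd hc2 (not_lt.mpr (le_trans ?_ (hle _ _ hmem)))
  rw [← ofReal_norm, ← VectorEmpirical.enorm_empiricalNu_sub P X hnpos (hint _ (hghat n ω))
    (hint _ hg₀) ω]
  gcongr
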